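/- Let $\alpha=\frac{16}{3}$, $\beta=\frac43$, $\gamma=4$ and let $\mathbf f_{\mathbb P_2}:[-\pi,\pi]^2\to\mathbb C^{4\times4}$ be the Hermitian matrix-valued function $$\mathbf f_{\mathbb P_2}(\theta_1,\theta_2)=\begin{bmatrix}\alpha&-\beta(1+e^{\mathrm i\theta_1})&-\beta(1+e^{\mathrm i\theta_2})&0\\-\beta(1+e^{-\mathrm i\theta_1})&\alpha&0&-\beta(1+e^{\mathrm i\theta_2})\\-\beta(1+e^{-\mathrm i\theta_2})&0&\alpha&-\beta(1+e^{\mathrm i\theta_1})\\0&-\beta(1+e^{-\mathrm i\theta_2})&-\beta(1+e^{-\mathrm i\theta_1})&\gamma+\frac\beta2(\cos\theta_1+\cos\theta_2)\end{bmatrix}.$$ Its range is $\mathcal R=\{\lambda\in\mathbb C:\lambda\text{ is an eigenvalue of }\mathbf f_{\mathbb P_2}(\theta)\text{ for some }\theta\in[-\pi,\pi]^2\}$, the union of the ranges of its eigenvalue functions. For $n\ge1$ let $T_n(\mathbf f_{\mathbb P_2})=[\hat{\mathbf f}_{\mathbf i-\mathbf j}]_{\mathbf i,\mathbf j\in\{1,\dots,n\}^2}$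 be the two-level block Toeplitz matrix of size $4n^2$ whose blocks are the Fourier coefficients $\hat{\mathbf f}_{\mathbf k}=\frac1{(2\pi)^2}\int_{[-\pi,\pi]^2}\mathbf f_{\mathbb P_2}(\theta)e^{-\mathrm i(k_1\theta_1+k_2\theta_2)}\,d\theta$. Let $\Omega=(0,1)^2$ and consider the Friedrichs-Keller triangulation of $\overline\Omega$ with step $1/n$ (the uniform square grid in which every cell is cut by its diagonal from the lower right to the upper left vertex). Let $V_h$ be the space of continuous functions on $\overline\Omega$ that are polynomials of degree at most $2$ on each triangle and vanish on $\partial\Omega$, and let $(\varphi_i)$ be its nodal basis, associated with the $(2n-1)^2$ internal nodes $(\frac p{2n},\frac q{2n})$, $1\le p,q\le 2n-1$. Let $A_n(1,\Omega,\mathbb P_2)=\big[\int_\Omega\nabla\varphi_j\cdot\nabla\varphi_i\big]_{i,j}$ be the stiffness matrix of the $\mathbb P_2$ Lagrangian finite elements for the Laplacian with homogeneous Dirichlet conditions. Then $\mathcal R$ is a non-empty closed subset of $\mathbb C$, and both matrix-sequences $\{T_n(\mathbf f_{\mathbb P_2})\}_n$ and $\{A_n(1,\Omega,\mathbb P_2)\}_n$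 are weakly clustered at $\mathcal R$ in the sense of the eigenvalues: for every $\epsilon>0$, the number of eigenvalues (counted with algebraic multiplicity) of the $n$-th matrix outside $\bigcup_{z\in\mathcal R}\{w\in\mathbb C:|w-z|<\epsilon\}$ is $o(d_n)$ as $n\to\infty$, where $d_n$ is the size of the matrix ($d_n=4n^2$ and $d_n=(2n-1)^2$, respectively). Furthermore, for every $n\ge1$, all the eigenvalues of $T_n(\mathbf f_{\mathbb P_2})$ and of $A_n(1,\Omega,\mathbb P_2)$ belong to the convex hull of $\mathcal R$. -/

import Mathlib

open MeasureTheory Filter Topology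
open scoped Real

/-! ### Clustering, range of a matrix-valued symbol -/

/-- The number of eigenvalues of `A`, counted with algebraic multiplicity, that lie outside `U`. -/
noncomputable def eigCountOutside {ι : Type*} [Fintype ι] [DecidableEq ι]
    (A : Matrix ι ι ℂ) (U : Set ℂ) : ℕ := by
  classical
  exact Multiset.card (A.charpoly.roots.filter (fun z => z ∉ U))

/-- The matrix-sequence `A` (with `A n` of size `d_n = card (ι n)`) is weakly clustered, in the
sense of the eigenvalues, at the non-empty closed set `S`: for every `ε > 0` the number of
eigenvalues of `A n` outside the `ε`-expansion of `S` is `o(d_n)`. -/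
def IsWeaklyClusteredAt {ι : ℕ → Type*} [∀ n, Fintype (ι n)] [∀ n, DecidableEq (ι n)]
    (A : ∀ n, Matrix (ι n) (ι n) ℂ) (S : Set ℂ) : Prop :=
  S.Nonempty ∧ IsClosed S ∧ ∀ ε : ℝ, 0 < ε →
    (fun n => (eigCountOutside (A n) (Metric.thickening ε S) : ℝ))
      =o[atTop] (fun n => (Fintype.card (ι n) : ℝ))

/-- The range of a matrix-valued function `f` on `D`: the union of the ranges of its eigenvalue
functions. -/
def eigenvalueRange {X r : Type*} [Fintype r] [DecidableEq r]
    (f : X → Matrix r r ℂ) (D : Set X) : Set ℂ :=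
  {z | ∃ θ ∈ D, z ∈ spectrum ℂ (f θ)}

/-! ### Two-level block Toeplitz matrices -/

/-- The square `[-π, π]²`. -/
def torusSquare : Set (ℝ × ℝ) := Set.Icc (-π) π ×ˢ Set.Icc (-π) π

/-- The Fourier coefficient `(2π)⁻² ∫ f(θ) exp(-i (k₁θ₁ + k₂θ₂)) dθ` over `[-π, π]²`, computed
componentwise. -/
noncomputable def fourierBlock {r : Type*} (f : ℝ × ℝ → Matrix r r ℂ) (k : ℤ × ℤ) :
    Matrix r r ℂ :=
  Matrix.of fun a b => (1 / (2 * (π : ℂ)) ^ 2) *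
    ∫ θ in torusSquare, f θ a b *
      Complex.exp (-Complex.I * ((k.1 : ℂ) * (θ.1 : ℂ) + (k.2 : ℂ) * (θ.2 : ℂ)))

/-- The two-level block Toeplitz matrix `T_{(n₁,n₂)}(f)`, whose block at the pair `(i, j)` of
two-indices is the Fourier coefficient of index `i - j`. -/
noncomputable def blockToeplitz {r : Type*} (n₁ n₂ : ℕ) (f : ℝ × ℝ → Matrix r r ℂ) :
    Matrix ((Fin n₁ × Fin n₂) × r) ((Fin n₁ × Fin n₂) × r) ℂ :=
  Matrix.of fun I J =>
    fourierBlock f (((I.1.1 : ℕ) : ℤ) - ((J.1.1 : ℕ) : ℤ), ((I.1.2 : ℕ) : ℤ) - ((J.1.2 : ℕ) : ℤ))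
      I.2 J.2

/-- The symbol `f_{ℙ₂}`, with `α = 16/3`, `β = 4/3`, `γ = 4`. -/
noncomputable def symbolP2 (θ : ℝ × ℝ) : Matrix (Fin 4) (Fin 4) ℂ :=
  let α : ℂ := 16 / 3
  let β : ℂ := 4 / 3
  let γ : ℂ := 4
  let e₁ : ℂ := Complex.exp (Complex.I * (θ.1 : ℂ))
  let e₂ : ℂ := Complex.exp (Complex.I * (θ.2 : ℂ))
  let e₁' : ℂ := Complex.exp (-Complex.I * (θ.1 : ℂ))
  let e₂' : ℂ := Complex.exp (-Complex.I * (θ.2 : ℂ))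
  !![α,               -β * (1 + e₁),   -β * (1 + e₂),   0;
     -β * (1 + e₁'),  α,               0,               -β * (1 + e₂);
     -β * (1 + e₂'),  0,               α,               -β * (1 + e₁);
     0,               -β * (1 + e₂'),  -β * (1 + e₁'),
       γ + β / 2 * (Complex.cos (θ.1 : ℂ) + Complex.cos (θ.2 : ℂ))]

/-! ### Quadratic Lagrangian finite elements on the Friedrichs-Keller triangulation -/

/-- The domain `Ω = (0,1)²`. -/
def unitSquare : Set (ℝ × ℝ) := Set.Ioo 0 1 ×ˢ Set.Ioo 0 1

/-- The Friedrichs-Keller triangulation of `[0,1]²` of step `h = 1/n`. Each cell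
`[a h, (a+1) h] × [b h, (b+1) h]` is cut along its diagonal from `((a+1) h, b h)` to
`(a h, (b+1) h)` into a triangle with its right angle at `(a h, b h)` and a triangle with its
right angle at `((a+1) h, (b+1) h)`. -/
def fkMesh (n : ℕ) : Set (Set (ℝ × ℝ)) :=
  {K | ∃ a b : Fin n,
    K = {x : ℝ × ℝ | (a : ℕ) ≤ n * x.1 ∧ (b : ℕ) ≤ n * x.2 ∧
          n * x.1 + n * x.2 ≤ (a : ℕ) + (b : ℕ) + 1} ∨
    K = {x : ℝ × ℝ | n * x.1 ≤ (a : ℕ) + 1 ∧ n * x.2 ≤ (b : ℕ) + 1 ∧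
          (a : ℕ) + (b : ℕ) + 1 ≤ n * x.1 + n * x.2}}

/-- The space `V_h` of `ℙ₂` Lagrangian finite elements: the functions that are continuous on the
closed square, agree with a polynomial of degree at most two on each triangle of the mesh, and
vanish on the boundary. -/
def p2Space (n : ℕ) : Set (ℝ × ℝ → ℝ) :=
  {φ | ContinuousOn φ (closure unitSquare) ∧
    (∀ K ∈ fkMesh n, ∃ p : MvPolynomial (Fin 2) ℝ, p.totalDegree ≤ 2 ∧
      ∀ x ∈ K, φ x = MvPolynomial.eval ![x.1, x.2] p) ∧
    ∀ x ∈ frontier unitSquare, φ x = 0}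

/-- Indices of the internal nodes (vertices and midpoints of edges) of the mesh of step `1/n`. -/
abbrev P2Index (n : ℕ) : Type := Fin (2 * n - 1) × Fin (2 * n - 1)

/-- The internal node of index `i`, that is `(P/(2n), Q/(2n))` with `1 ≤ P, Q ≤ 2n - 1`. -/
noncomputable def p2Node (n : ℕ) (i : P2Index n) : ℝ × ℝ :=
  ((((i.1 : ℕ) + 1 : ℕ) : ℝ) / (2 * n), (((i.2 : ℕ) + 1 : ℕ) : ℝ) / (2 * n))

/-- The hat function of the vertex `(p/n, q/n)`: it is affine on each triangle, equal to `1` at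
this vertex and to `0` at every other vertex. -/
noncomputable def fkHat (n p q : ℕ) (x : ℝ × ℝ) : ℝ :=
  max 0 (1 - max (max |n * x.1 - p| |n * x.2 - q|) |(n * x.1 - p) + (n * x.2 - q)|)

/-- The nodal basis function `φ_i` of `V_h`: `λ (2 λ - 1)` at a vertex with hat function `λ`, and
`4 λ μ` at the midpoint of an edge whose end points have the hat functions `λ` and `μ`. -/
noncomputable def p2Basis (n : ℕ) (i : P2Index n) (x : ℝ × ℝ) : ℝ :=
  let P : ℕ := (i.1 : ℕ) + 1
  let Q : ℕ := (i.2 : ℕ) + 1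
  if Even P ∧ Even Q then
    fkHat n (P / 2) (Q / 2) x * (2 * fkHat n (P / 2) (Q / 2) x - 1)
  else
    4 * fkHat n (P / 2) ((Q + 1) / 2) x * fkHat n ((P + 1) / 2) (Q / 2) x

/-- The partial derivative of `φ` in the first variable. -/
noncomputable def partialX (φ : ℝ × ℝ → ℝ) (x : ℝ × ℝ) : ℝ := deriv (fun s => φ (s, x.2)) x.1

/-- The partial derivative of `φ` in the second variable. -/
noncomputable def partialY (φ : ℝ × ℝ → ℝ) (x : ℝ × ℝ) : ℝ := deriv (fun t => φ (x.1, t)) x.2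

/-- The stiffness matrix `A_n(a, Ω, ℙ₂)` on `Ω = (0,1)²`, with entries
`∫_Ω a ∇φ_j · ∇φ_i`. (The gradients exist off the edges of the mesh, a null set.) -/
noncomputable def stiffnessP2 (a : ℝ × ℝ → ℝ) (n : ℕ) : Matrix (P2Index n) (P2Index n) ℝ :=
  Matrix.of fun i j => ∫ x in unitSquare,
    a x * (partialX (p2Basis n j) x * partialX (p2Basis n i) x +
      partialY (p2Basis n j) x * partialY (p2Basis n i) x)

/-! ### The functions `φ_i` are the nodal basis of `V_h` -/

/-- The hat functions are continuous. -/
theorem fkHat_continuous (n p q : ℕ) : Continuous (fkHat n p q) := by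
  unfold fkHat
  fun_prop

/-- Values of a hat function on a reference triangle. -/
theorem fkHat_ref (s t : ℝ) (hs : 0 ≤ s) (ht : 0 ≤ t) (hst : s + t ≤ 1) (d e : ℤ) :
    max 0 (1 - max (max |s - d| |t - e|) |(s - d) + (t - e)|) =
      if d = 0 ∧ e = 0 then 1 - s - t else if d = 1 ∧ e = 0 then s else
        if d = 0 ∧ e = 1 then t else 0 := by
  have key : (d = 0 ∧ e = 0) ∨ (d = 1 ∧ e = 0) ∨ (d = 0 ∧ e = 1) ∨
      (d ≤ -1 ∨ 2 ≤ d ∨ e ≤ -1 ∨ 2 ≤ e ∨ (1 ≤ d ∧ 1 ≤ e)) := by omega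
  rcases key with ⟨rfl, rfl⟩ | ⟨rfl, rfl⟩ | ⟨rfl, rfl⟩ | h
  · simp only [Int.cast_zero, sub_zero, and_self, if_true]
    rw [abs_of_nonneg hs, abs_of_nonneg ht, abs_of_nonneg (by linarith : 0 ≤ s + t),
      max_eq_right (max_le (by linarith) (by linarith) : max s t ≤ s + t),
      max_eq_right (by linarith : 0 ≤ 1 - (s + t))]
    ring
  · simp only [Int.cast_zero, Int.cast_one, sub_zero, one_ne_zero, and_true, if_true, if_false]
    rw [abs_of_nonpos (by linarith : s - 1 ≤ 0), abs_of_nonneg ht,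
      abs_of_nonpos (by linarith : s - 1 + t ≤ 0), max_eq_left (by linarith : t ≤ -(s - 1)),
      max_eq_left (by linarith : -(s - 1 + t) ≤ -(s - 1)),
      max_eq_right (by linarith : 0 ≤ 1 - -(s - 1))]
    ring
  · rw [if_neg (by omega), if_neg (by omega), if_pos (by omega)]
    simp only [Int.cast_zero, Int.cast_one, sub_zero]
    rw [abs_of_nonneg hs, abs_of_nonpos (by linarith : t - 1 ≤ 0),
      abs_of_nonpos (by linarith : s + (t - 1) ≤ 0), max_eq_right (by linarith : s ≤ -(t - 1)),
      max_eq_left (by linarith : -(s + (t - 1)) ≤ -(t - 1)),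
      max_eq_right (by linarith : 0 ≤ 1 - -(t - 1))]
    ring
  · rw [if_neg (by omega), if_neg (by omega), if_neg (by omega)]
    apply max_eq_left
    rw [sub_nonpos, le_max_iff, le_max_iff]
    rcases h with h | h | h | h | ⟨h, h'⟩
    · have : (d : ℝ) ≤ -1 := by exact_mod_cast h
      exact Or.inl (Or.inl (le_abs.2 (Or.inl (by linarith))))
    · have : (2 : ℝ) ≤ d := by exact_mod_cast h
      exact Or.inl (Or.inl (le_abs.2 (Or.inr (by linarith))))
    · have : (e : ℝ) ≤ -1 := by exact_mod_cast h
      exact Or.inl (Or.inr (le_abs.2 (Or.inl (by linarith))))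
    · have : (2 : ℝ) ≤ e := by exact_mod_cast h
      exact Or.inl (Or.inr (le_abs.2 (Or.inr (by linarith))))
    · have h1 : (1 : ℝ) ≤ d := by exact_mod_cast h
      have h2 : (1 : ℝ) ≤ e := by exact_mod_cast h'
      exact Or.inr (le_abs.2 (Or.inr (by linarith)))

/-- The hat functions are affine on each triangle. -/
theorem fkHat_affine (n p q : ℕ) (K : Set (ℝ × ℝ)) (hK : K ∈ fkMesh n) :
    ∃ c₀ c₁ c₂ : ℝ, ∀ x ∈ K, fkHat n p q x = c₀ + c₁ * x.1 + c₂ * x.2 := by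
  obtain ⟨a, b, rfl | rfl⟩ := hK
  · have h : ∀ x : ℝ × ℝ, (a : ℕ) ≤ n * x.1 ∧ (b : ℕ) ≤ n * x.2 ∧
          n * x.1 + n * x.2 ≤ (a : ℕ) + (b : ℕ) + 1 → fkHat n p q x =
          if (p : ℤ) - (a : ℕ) = 0 ∧ (q : ℤ) - (b : ℕ) = 0 then
            1 - (n * x.1 - (a : ℕ)) - (n * x.2 - (b : ℕ))
          else if (p : ℤ) - (a : ℕ) = 1 ∧ (q : ℤ) - (b : ℕ) = 0 then n * x.1 - (a : ℕ)
          else if (p : ℤ) - (a : ℕ) = 0 ∧ (q : ℤ) - (b : ℕ) = 1 then n * x.2 - (b : ℕ)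
          else 0 := fun x hx => by
      have := fkHat_ref (n * x.1 - (a : ℕ)) (n * x.2 - (b : ℕ)) (by linarith [hx.1])
        (by linarith [hx.2.1]) (by linarith [hx.2.2]) ((p : ℤ) - (a : ℕ)) ((q : ℤ) - (b : ℕ))
      push_cast at this
      rw [sub_sub_sub_cancel_right, sub_sub_sub_cancel_right] at this
      exact this
    by_cases h1 : (p : ℤ) - (a : ℕ) = 0 ∧ (q : ℤ) - (b : ℕ) = 0
    · exact ⟨1 + (a : ℕ) + (b : ℕ), -n, -n, fun x hx => by rw [h x hx, if_pos h1]; ring⟩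
    by_cases h2 : (p : ℤ) - (a : ℕ) = 1 ∧ (q : ℤ) - (b : ℕ) = 0
    · exact ⟨-(a : ℕ), n, 0, fun x hx => by rw [h x hx, if_neg h1, if_pos h2]; ring⟩
    by_cases h3 : (p : ℤ) - (a : ℕ) = 0 ∧ (q : ℤ) - (b : ℕ) = 1
    · exact ⟨-(b : ℕ), 0, n, fun x hx => by
        rw [h x hx, if_neg h1, if_neg h2, if_pos h3]; ring⟩
    · exact ⟨0, 0, 0, fun x hx => by rw [h x hx, if_neg h1, if_neg h2, if_neg h3]; ring⟩
  · have h : ∀ x : ℝ × ℝ, n * x.1 ≤ (a : ℕ) + 1 ∧ n * x.2 ≤ (b : ℕ) + 1 ∧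
          (a : ℕ) + (b : ℕ) + 1 ≤ n * x.1 + n * x.2 → fkHat n p q x =
          if (a : ℕ) + 1 - (p : ℤ) = 0 ∧ (b : ℕ) + 1 - (q : ℤ) = 0 then
            1 - ((a : ℕ) + 1 - n * x.1) - ((b : ℕ) + 1 - n * x.2)
          else if (a : ℕ) + 1 - (p : ℤ) = 1 ∧ (b : ℕ) + 1 - (q : ℤ) = 0 then
            (a : ℕ) + 1 - n * x.1
          else if (a : ℕ) + 1 - (p : ℤ) = 0 ∧ (b : ℕ) + 1 - (q : ℤ) = 1 then
            (b : ℕ) + 1 - n * x.2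
          else 0 := fun x hx => by
      have := fkHat_ref ((a : ℕ) + 1 - n * x.1) ((b : ℕ) + 1 - n * x.2) (by linarith [hx.1])
        (by linarith [hx.2.1]) (by linarith [hx.2.2])
        ((a : ℕ) + 1 - (p : ℤ)) ((b : ℕ) + 1 - (q : ℤ))
      push_cast at this
      rw [sub_sub_sub_cancel_left, sub_sub_sub_cancel_left, abs_sub_comm (p : ℝ),
        abs_sub_comm (q : ℝ), ← abs_neg ((p : ℝ) - _ + _),
        show -((p : ℝ) - n * x.1 + (q - n * x.2)) = (n * x.1 - p) + (n * x.2 - q) by ring] at this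
      exact this
    by_cases h1 : (a : ℕ) + 1 - (p : ℤ) = 0 ∧ (b : ℕ) + 1 - (q : ℤ) = 0
    · exact ⟨-1 - (a : ℕ) - (b : ℕ), n, n, fun x hx => by rw [h x hx, if_pos h1]; ring⟩
    by_cases h2 : (a : ℕ) + 1 - (p : ℤ) = 1 ∧ (b : ℕ) + 1 - (q : ℤ) = 0
    · exact ⟨(a : ℕ) + 1, -n, 0, fun x hx => by rw [h x hx, if_neg h1, if_pos h2]; ring⟩
    by_cases h3 : (a : ℕ) + 1 - (p : ℤ) = 0 ∧ (b : ℕ) + 1 - (q : ℤ) = 1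
    · exact ⟨(b : ℕ) + 1, 0, -n, fun x hx => by
        rw [h x hx, if_neg h1, if_neg h2, if_pos h3]; ring⟩
    · exact ⟨0, 0, 0, fun x hx => by rw [h x hx, if_neg h1, if_neg h2, if_neg h3]; ring⟩

/-- A product of two affine functions is a polynomial of degree at most two. -/
theorem affine_mul_affine (c : ℝ) (u v : Fin 3 → ℝ) :
    ∃ p : MvPolynomial (Fin 2) ℝ, p.totalDegree ≤ 2 ∧ ∀ x : ℝ × ℝ,
      c * (u 0 + u 1 * x.1 + u 2 * x.2) * (v 0 + v 1 * x.1 + v 2 * x.2) =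
        MvPolynomial.eval ![x.1, x.2] p := by
  have aff : ∀ w : Fin 3 → ℝ, (MvPolynomial.C (w 0) + MvPolynomial.C (w 1) * MvPolynomial.X 0 +
      MvPolynomial.C (w 2) * MvPolynomial.X 1 : MvPolynomial (Fin 2) ℝ).totalDegree ≤ 1 := by
    intro w
    have hX : ∀ (z : ℝ) (k : Fin 2),
        (MvPolynomial.C z * MvPolynomial.X k : MvPolynomial (Fin 2) ℝ).totalDegree ≤ 1 :=
      fun z k => (MvPolynomial.totalDegree_mul _ _).trans (by simp)
    refine (MvPolynomial.totalDegree_add _ _).trans (max_le ?_ (hX _ _))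
    exact (MvPolynomial.totalDegree_add _ _).trans (max_le (by simp) (hX _ _))
  refine ⟨MvPolynomial.C c * ((MvPolynomial.C (u 0) + MvPolynomial.C (u 1) * MvPolynomial.X 0 +
      MvPolynomial.C (u 2) * MvPolynomial.X 1) * (MvPolynomial.C (v 0) +
      MvPolynomial.C (v 1) * MvPolynomial.X 0 + MvPolynomial.C (v 2) * MvPolynomial.X 1)), ?_, ?_⟩
  · refine (MvPolynomial.totalDegree_mul _ _).trans ?_
    rw [MvPolynomial.totalDegree_C, zero_add]
    refine (MvPolynomial.totalDegree_mul _ _).trans ?_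
    have h1 := aff u
    have h2 := aff v
    omega
  · intro x
    simp [mul_assoc]

/-- A hat function vanishes at distance at least one mesh step, in either coordinate. -/
theorem fkHat_eq_zero (n p q : ℕ) (x : ℝ × ℝ)
    (h : 1 ≤ |n * x.1 - p| ∨ 1 ≤ |n * x.2 - q|) : fkHat n p q x = 0 := by
  unfold fkHat
  apply max_eq_left
  rw [sub_nonpos, le_max_iff, le_max_iff]
  exact Or.inl h

/-- The functions `φ_i` belong to `V_h`. -/
theorem p2Basis_mem (n : ℕ) (i : P2Index n) : p2Basis n i ∈ p2Space n := by
  refine ⟨?_, ?_, ?_⟩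
  · apply Continuous.continuousOn
    unfold p2Basis
    dsimp only
    have h := fkHat_continuous n
    split_ifs
    · exact (h _ _).mul ((continuous_const.mul (h _ _)).sub continuous_const)
    · exact (continuous_const.mul (h _ _)).mul (h _ _)
  · intro K hK
    unfold p2Basis
    dsimp only
    split_ifs
    · obtain ⟨c₀, c₁, c₂, h⟩ := fkHat_affine n _ _ K hK
      obtain ⟨p, hp, hq⟩ := affine_mul_affine 1 ![c₀, c₁, c₂] ![2 * c₀ - 1, 2 * c₁, 2 * c₂]
      refine ⟨p, hp, fun x hx => ?_⟩
      rw [h x hx, ← hq]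
      simp only [Matrix.cons_val]
      ring
    · obtain ⟨c₀, c₁, c₂, h⟩ := fkHat_affine n _ _ K hK
      obtain ⟨d₀, d₁, d₂, h'⟩ := fkHat_affine n _ _ K hK
      obtain ⟨p, hp, hq⟩ := affine_mul_affine 4 ![c₀, c₁, c₂] ![d₀, d₁, d₂]
      refine ⟨p, hp, fun x hx => ?_⟩
      rw [h x hx, h' x hx, ← hq]
      simp
  · intro x hx
    have hi1 := i.1.isLt
    have hi2 := i.2.isLt
    have hx' : x.1 = 0 ∨ x.1 = 1 ∨ x.2 = 0 ∨ x.2 = 1 := by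
      rw [unitSquare, frontier_prod_eq, frontier_Ioo one_pos] at hx
      rcases hx with ⟨_, hx⟩ | ⟨hx, _⟩
      · rcases hx with hx | hx
        · exact Or.inr (Or.inr (Or.inl hx))
        · exact Or.inr (Or.inr (Or.inr hx))
      · rcases hx with hx | hx
        · exact Or.inl hx
        · exact Or.inr (Or.inl hx)
    have h1 : ∀ p : ℕ, 1 ≤ p → p + 1 ≤ n → 1 ≤ |(n : ℝ) * 0 - p| ∧ 1 ≤ |(n : ℝ) * 1 - p| := by
      intro p hp hpn
      have a : (1 : ℝ) ≤ p := by exact_mod_cast hp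
      have b : (p : ℝ) + 1 ≤ n := by exact_mod_cast hpn
      exact ⟨le_abs.2 (Or.inr (by linarith)), le_abs.2 (Or.inl (by linarith))⟩
    have h0 : ∀ p : ℕ, p + 1 ≤ n → 1 ≤ |(n : ℝ) * 1 - p| := by
      intro p hpn
      have b : (p : ℝ) + 1 ≤ n := by exact_mod_cast hpn
      exact le_abs.2 (Or.inl (by linarith))
    have h0' : ∀ p : ℕ, 1 ≤ p → 1 ≤ |(n : ℝ) * 0 - p| := by
      intro p hp
      have a : (1 : ℝ) ≤ p := by exact_mod_cast hp
      exact le_abs.2 (Or.inr (by linarith))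
    unfold p2Basis
    dsimp only
    split_ifs with hPQ
    · obtain ⟨⟨k, hk⟩, ⟨l, hl⟩⟩ := hPQ
      rw [fkHat_eq_zero, zero_mul]
      rcases hx' with h | h | h | h
      · exact Or.inl (by rw [h]; exact h0' _ (by omega))
      · exact Or.inl (by rw [h]; exact h0 _ (by omega))
      · exact Or.inr (by rw [h]; exact h0' _ (by omega))
      · exact Or.inr (by rw [h]; exact h0 _ (by omega))
    · rcases hx' with h | h | h | h
      · rw [mul_comm, fkHat_eq_zero, zero_mul]
        exact Or.inl (by rw [h]; exact h0' _ (by omega))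
      · rw [fkHat_eq_zero, mul_zero, zero_mul]
        exact Or.inl (by rw [h]; exact h0 _ (by omega))
      · rw [fkHat_eq_zero, mul_zero, zero_mul]
        exact Or.inr (by rw [h]; exact h0' _ (by omega))
      · rw [mul_comm, fkHat_eq_zero, zero_mul]
        exact Or.inr (by rw [h]; exact h0 _ (by omega))

/-- Values of a hat function at the nodes. -/
theorem fkHat_node (n p q : ℕ) (j : P2Index n) (hn : 0 < n) :
    fkHat n p q (p2Node n j) =
      ((max 0 (2 - max (max |(j.1 : ℤ) + 1 - 2 * p| |(j.2 : ℤ) + 1 - 2 * q|)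
        |((j.1 : ℤ) + 1 - 2 * p) + ((j.2 : ℤ) + 1 - 2 * q)|) : ℤ) : ℝ) / 2 := by
  have hn' : (n : ℝ) ≠ 0 := by positivity
  have e : ∀ m : ℕ, (n : ℝ) * (((m + 1 : ℕ) : ℝ) / (2 * n)) = ((m : ℝ) + 1) / 2 := by
    intro m
    push_cast
    field_simp
  unfold fkHat p2Node
  dsimp only
  rw [e, e]
  push_cast
  have g : ∀ y : ℝ, |y| / 2 = |y / 2| := fun y => by rw [abs_div, abs_two]
  have m : ∀ y z : ℝ, max y z / 2 = max (y / 2) (z / 2) :=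
    fun y z => (max_div_div_right (by norm_num : (0 : ℝ) ≤ 2) y z).symm
  rw [m, sub_div, m, m, g, g, g]
  ring_nf

/-- Integer form of the values of a hat function at the nodes. -/
theorem hatInt_cases (m k : ℤ) :
    max 0 (2 - max (max |m| |k|) |m + k|) = if m = 0 ∧ k = 0 then 2 else
      if (m = 1 ∧ k = 0) ∨ (m = -1 ∧ k = 0) ∨ (m = 0 ∧ k = 1) ∨ (m = 0 ∧ k = -1) ∨
        (m = 1 ∧ k = -1) ∨ (m = -1 ∧ k = 1) then 1 else 0 := by
  rcases abs_cases m with ⟨h1, _⟩ | ⟨h1, _⟩ <;> rcases abs_cases k with ⟨h2, _⟩ | ⟨h2, _⟩ <;>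
    rcases abs_cases (m + k) with ⟨h3, _⟩ | ⟨h3, _⟩ <;> rw [h1, h2, h3] <;> split_ifs <;> omega

/-- The nodal property of the functions `φ_i`: `φ_i (node j) = δ_ij`. -/
theorem p2Basis_node (n : ℕ) (i j : P2Index n) :
    p2Basis n i (p2Node n j) = if i = j then 1 else 0 := by
  have hi1 := i.1.isLt
  have hn : 0 < n := by omega
  have hij : i = j ↔ (i.1 : ℕ) = j.1 ∧ (i.2 : ℕ) = j.2 := by
    rw [Prod.ext_iff, Fin.ext_iff, Fin.ext_iff]
  rw [if_congr hij rfl rfl]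
  unfold p2Basis
  dsimp only
  rw [fkHat_node n _ _ j hn, fkHat_node n _ _ j hn, fkHat_node n _ _ j hn,
    hatInt_cases, hatInt_cases, hatInt_cases]
  generalize (i.1 : ℕ) = P
  generalize (i.2 : ℕ) = Q
  generalize (j.1 : ℕ) = u
  generalize (j.2 : ℕ) = v
  by_cases hPQ : Even (P + 1) ∧ Even (Q + 1)
  · rw [if_pos hPQ]
    rw [Nat.even_iff, Nat.even_iff] at hPQ
    by_cases hE : P = u ∧ Q = v
    · rw [if_pos hE, if_pos (by omega)]
      norm_num
    · rw [if_neg hE, if_neg (by omega)]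
      split_ifs <;> norm_num
  · rw [if_neg hPQ]
    rw [Nat.even_iff, Nat.even_iff] at hPQ
    by_cases hE : P = u ∧ Q = v
    · rw [if_pos hE, if_neg (by omega), if_pos (by omega), if_neg (by omega), if_pos (by omega)]
      norm_num
    · rw [if_neg hE]
      split_ifs <;> first | (exfalso; omega) | norm_num

/-! The range of the symbol is exactly the interval `[0, 32/3]`, and for `n ≥ 1` every eigenvalue of
both matrices already lies in it. So no eigenvalue is ever an outlier, the count is eventually zero
rather than merely `o(d_n)`, and the convex hull adds nothing. Everything reduces to bounds `0 ≤
⟨Ax, x⟩ ≤ (32/3)‖x‖²` on quadratic forms.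

For the symbol, `symbolP2_quadForm` writes both `f` and `32/3 - f` as sums of squares. Conversely,
`det (f(θ) - t)` is real and continuous on the connected square, is `≤ 0` at `(0, 0)` and is `≥ 0`
at `(π, π)` or `(π, 0)`, for each `t` in `[0, 32/3]`; a zero in between makes `t` an eigenvalue
(`eigenvalueRange_symbolP2`).

The Toeplitz form is the mean of the form of the symbol at a vector of trigonometric polynomials,
and Parseval turns the mean of the squared norms of that vector into `‖x‖²`; hence the bounds pass
from the symbol to the matrix.

The stiffness form is the Dirichlet energy of a finite element function, hence nonnegative. Each
triangle is the image of one reference triangle under a translation and a scalar multiplication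
(negative for the upper triangles), and in the plane the energy is invariant under such maps. A
Gershgorin bound on the reference triangle (`refEnergy_self_le`), summed over the mesh, gives every
internal node the same total weight `32/3` (`sum_mesh_weights`). -/

/-! ### Spectra from quadratic forms, and clustering -/

/-- If the quadratic form of `A` is real and lies between `0` and `c‖x‖²`, then the spectrum of `A`
lies in `[0, c]`. -/
theorem spectrum_subset_Icc_of_quadForm {ι : Type*} [Fintype ι] [DecidableEq ι]
    (A : Matrix ι ι ℂ) (c : ℝ)
    (h : ∀ x : ι → ℂ, ∃ q : ℝ, star x ⬝ᵥ A.mulVec x = (q : ℂ) ∧ 0 ≤ q ∧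
      q ≤ c * ∑ i, Complex.normSq (x i)) :
    spectrum ℂ A ⊆ ((↑) : ℝ → ℂ) '' Set.Icc 0 c := by
  intro z hz
  rw [← Matrix.spectrum_toLin', ← Module.End.hasEigenvalue_iff_mem_spectrum] at hz
  obtain ⟨v, hv⟩ := hz.exists_hasEigenvector
  have hv1 : A.mulVec v = z • v := by
    have := hv.apply_eq_smul
    rwa [Matrix.toLin'_apply] at this
  obtain ⟨q, hq, hq0, hqc⟩ := h v
  set N : ℝ := ∑ i, Complex.normSq (v i) with hN
  have hNpos : 0 < N := by
    obtain ⟨i, hi⟩ := Function.ne_iff.1 hv.2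
    exact Finset.sum_pos' (fun i _ => Complex.normSq_nonneg _)
      ⟨i, Finset.mem_univ i, Complex.normSq_pos.2 hi⟩
  have hzN : z * (N : ℂ) = (q : ℂ) := by
    rw [← hq, hv1, dotProduct_smul, smul_eq_mul, hN]
    congr 1
    simp only [dotProduct, Pi.star_apply, Complex.ofReal_sum]
    exact Finset.sum_congr rfl fun i _ => Complex.normSq_eq_conj_mul_self
  refine ⟨q / N, ⟨div_nonneg hq0 hNpos.le, (div_le_iff₀ hNpos).2 hqc⟩, ?_⟩
  push_cast
  rw [div_eq_iff (by exact_mod_cast hNpos.ne'), hzN]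

/-- The quadratic form of a real symmetric matrix at a complex vector. -/
theorem star_dotProduct_map_ofReal_mulVec {ι : Type*} [Fintype ι] (A : Matrix ι ι ℝ)
    (hA : ∀ i j, A i j = A j i) (z : ι → ℂ) :
    star z ⬝ᵥ (A.map (fun t : ℝ => (t : ℂ))).mulVec z =
      (((∑ i, ∑ j, (z i).re * A i j * (z j).re) + ∑ i, ∑ j, (z i).im * A i j * (z j).im : ℝ) :
        ℂ) := by
  -- By symmetry the two cross terms between real and imaginary parts agree, so the imaginary part
  -- of the form vanishes.
  have him : ∑ i, ∑ j, (z i).im * A i j * (z j).re = ∑ i, ∑ j, (z i).re * A i j * (z j).im := by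
    rw [Finset.sum_comm]
    refine Finset.sum_congr rfl fun i _ => Finset.sum_congr rfl fun j _ => ?_
    rw [hA j i]
    ring
  simp only [dotProduct, Matrix.mulVec, Finset.mul_sum, Matrix.map_apply, Pi.star_apply]
  apply Complex.ext
  · simp only [Complex.re_sum, Complex.ofReal_re, ← Finset.sum_add_distrib]
    refine Finset.sum_congr rfl fun i _ => Finset.sum_congr rfl fun j _ => ?_
    simp
    ring
  · simp only [Complex.im_sum, Complex.ofReal_im]
    rw [← sub_eq_zero_of_eq him.symm, ← Finset.sum_sub_distrib]
    refine Finset.sum_congr rfl fun i _ => ?_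
    rw [← Finset.sum_sub_distrib]
    refine Finset.sum_congr rfl fun j _ => ?_
    simp
    ring

/-- If the quadratic form of a real symmetric matrix lies between `0` and `c‖x‖²`, then its complex
spectrum lies in `[0, c]`. -/
theorem spectrum_map_ofReal_subset_Icc {ι : Type*} [Fintype ι] [DecidableEq ι]
    (A : Matrix ι ι ℝ) (hA : ∀ i j, A i j = A j i) (c : ℝ)
    (h : ∀ x : ι → ℝ, 0 ≤ ∑ i, ∑ j, x i * A i j * x j ∧
      ∑ i, ∑ j, x i * A i j * x j ≤ c * ∑ i, x i ^ 2) :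
    spectrum ℂ (A.map (fun t : ℝ => (t : ℂ))) ⊆ ((↑) : ℝ → ℂ) '' Set.Icc 0 c := by
  refine spectrum_subset_Icc_of_quadForm _ c fun z =>
    ⟨_, star_dotProduct_map_ofReal_mulVec A hA z, ?_, ?_⟩
  · exact add_nonneg (h fun i => (z i).re).1 (h fun i => (z i).im).1
  · refine (add_le_add (h fun i => (z i).re).2 (h fun i => (z i).im).2).trans_eq ?_
    rw [← mul_add, ← Finset.sum_add_distrib]
    simp only [Complex.normSq_apply, sq]

/-- A matrix-sequence whose spectra are eventually contained in a closed set is weakly clustered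
at it. -/
theorem isWeaklyClusteredAt_of_spectrum_subset {ι : ℕ → Type*} [∀ n, Fintype (ι n)]
    [∀ n, DecidableEq (ι n)] (A : ∀ n, Matrix (ι n) (ι n) ℂ) {S : Set ℂ} (hne : S.Nonempty)
    (hcl : IsClosed S) (h : ∀ᶠ n in atTop, spectrum ℂ (A n) ⊆ S) : IsWeaklyClusteredAt A S := by
  refine ⟨hne, hcl, fun ε hε => ?_⟩
  refine (Asymptotics.isLittleO_zero _ _).congr' ?_ EventuallyEq.rfl
  filter_upwards [h] with n hn
  symm
  classical
  unfold eigCountOutside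
  refine Nat.cast_eq_zero.2 (Multiset.card_eq_zero.2 (Multiset.filter_eq_nil.2 fun z hz hzS => ?_))
  exact hzS (Metric.self_subset_thickening hε S
    (hn (Matrix.mem_spectrum_of_isRoot_charpoly (Polynomial.isRoot_of_mem_roots hz))))

/-! ### The symbol and its range -/

/-- The symbol takes its values between `0` and `32/3` in the Loewner order. -/
theorem symbolP2_quadForm (θ : ℝ × ℝ) (x : Fin 4 → ℂ) :
    ∃ q : ℝ, star x ⬝ᵥ (symbolP2 θ).mulVec x = (q : ℂ) ∧ 0 ≤ q ∧
      q ≤ 32 / 3 * ∑ i, Complex.normSq (x i) := by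
  obtain ⟨e, he⟩ : ∃ e : ℂ, e = Complex.exp (Complex.I * (θ.1 : ℂ)) := ⟨_, rfl⟩
  obtain ⟨f, hf⟩ : ∃ f : ℂ, f = Complex.exp (Complex.I * (θ.2 : ℂ)) := ⟨_, rfl⟩
  have he' : Complex.exp (-Complex.I * (θ.1 : ℂ)) = (starRingEnd ℂ) e := by
    rw [he, ← Complex.exp_conj]; simp
  have hf' : Complex.exp (-Complex.I * (θ.2 : ℂ)) = (starRingEnd ℂ) f := by
    rw [hf, ← Complex.exp_conj]; simp
  have hee : e * (starRingEnd ℂ) e = 1 := by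
    rw [← he', he, ← Complex.exp_add]; simp
  have hff : f * (starRingEnd ℂ) f = 1 := by
    rw [← hf', hf, ← Complex.exp_add]; simp
  have hce : Complex.cos (θ.1 : ℂ) = (e + (starRingEnd ℂ) e) / 2 := by
    rw [Complex.cos, ← he', he]; ring_nf
  have hcf : Complex.cos (θ.2 : ℂ) = (f + (starRingEnd ℂ) f) / 2 := by
    rw [Complex.cos, ← hf', hf]; ring_nf
  have expand : star x ⬝ᵥ (symbolP2 θ).mulVec x =
      (starRingEnd ℂ) (x 0) * (16 / 3 * x 0 - 4 / 3 * (1 + e) * x 1 - 4 / 3 * (1 + f) * x 2) +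
      (starRingEnd ℂ) (x 1) * (-(4 / 3) * (1 + (starRingEnd ℂ) e) * x 0 + 16 / 3 * x 1
        - 4 / 3 * (1 + f) * x 3) +
      (starRingEnd ℂ) (x 2) * (-(4 / 3) * (1 + (starRingEnd ℂ) f) * x 0 + 16 / 3 * x 2
        - 4 / 3 * (1 + e) * x 3) +
      (starRingEnd ℂ) (x 3) * (-(4 / 3) * (1 + (starRingEnd ℂ) f) * x 1
        - 4 / 3 * (1 + (starRingEnd ℂ) e) * x 2 +
        (4 + 2 / 3 * ((e + (starRingEnd ℂ) e) / 2 + (f + (starRingEnd ℂ) f) / 2)) * x 3) := by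
    simp only [symbolP2, ← he, ← hf, he', hf', hce, hcf, dotProduct, Matrix.mulVec,
      Fin.sum_univ_four, Pi.star_apply, Matrix.of_apply, Matrix.cons_val, RCLike.star_def]
    ring
  -- Each entry `-β(1 + e)` in the row of `x 0` splits into two squares of weight `4/3`. This uses
  -- up the coefficient of `x 0` and leaves `8/3` for each of `x 1`, `x 2`, whose squares are then
  -- completed with `x 3`. What remains for `x 3` is `4 + 2/3 (cos θ₁ + cos θ₂) - 2/3 (|1+e|² +
  -- |1+f|²) = 1/3 (|1-e|² + |1-f|²)`.
  refine ⟨4 / 3 * (Complex.normSq (x 0 - x 1) + Complex.normSq (x 0 - e * x 1) +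
      Complex.normSq (x 0 - x 2) + Complex.normSq (x 0 - f * x 2)) +
      8 / 3 * (Complex.normSq (x 1 - (1 + f) / 2 * x 3) +
        Complex.normSq (x 2 - (1 + e) / 2 * x 3)) +
      1 / 3 * (Complex.normSq ((1 - f) * x 3) + Complex.normSq ((1 - e) * x 3)), ?_, ?_, ?_⟩
  · rw [expand]
    push_cast
    simp only [← Complex.mul_conj]
    simp only [map_add, map_sub, map_mul, map_div₀, map_one, map_ofNat]
    -- With the conjugates as independent variables, this is a polynomial identity modulo `e e' = 1`
    -- and `f f' = 1`.
    generalize (starRingEnd ℂ) (x 0) = y0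
    generalize (starRingEnd ℂ) (x 1) = y1
    generalize (starRingEnd ℂ) (x 2) = y2
    generalize (starRingEnd ℂ) (x 3) = y3
    generalize (starRingEnd ℂ) e = e' at *
    generalize (starRingEnd ℂ) f = f' at *
    linear_combination (-(4 / 3) * x 1 * y1 - x 3 * y3) * hee +
      (-(4 / 3) * x 2 * y2 - x 3 * y3) * hff
  · have h := Complex.normSq_nonneg
    linarith [h (x 0 - x 1), h (x 0 - e * x 1), h (x 0 - x 2), h (x 0 - f * x 2),
      h (x 1 - (1 + f) / 2 * x 3), h (x 2 - (1 + e) / 2 * x 3), h ((1 - f) * x 3),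
      h ((1 - e) * x 3)]
  -- The off-diagonal entries only couple `{x 0, x 3}` with `{x 1, x 2}`, and `32/3 - α = α`. So the
  -- form of `32/3 - f` is obtained by changing the signs of `x 1` and `x 2` and adjusting the last
  -- diagonal entry, which raises the weight of the remainder from `1/3` to `1`.
  · have key : 32 / 3 * ∑ i, Complex.normSq (x i) -
      (4 / 3 * (Complex.normSq (x 0 - x 1) + Complex.normSq (x 0 - e * x 1) +
      Complex.normSq (x 0 - x 2) + Complex.normSq (x 0 - f * x 2)) +
      8 / 3 * (Complex.normSq (x 1 - (1 + f) / 2 * x 3) +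
        Complex.normSq (x 2 - (1 + e) / 2 * x 3)) +
      1 / 3 * (Complex.normSq ((1 - f) * x 3) + Complex.normSq ((1 - e) * x 3))) =
      4 / 3 * (Complex.normSq (x 0 + x 1) + Complex.normSq (x 0 + e * x 1) +
      Complex.normSq (x 0 + x 2) + Complex.normSq (x 0 + f * x 2)) +
      8 / 3 * (Complex.normSq (x 1 + (1 + f) / 2 * x 3) +
        Complex.normSq (x 2 + (1 + e) / 2 * x 3)) +
      (Complex.normSq ((1 - f) * x 3) + Complex.normSq ((1 - e) * x 3)) := by
      apply Complex.ofReal_injective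
      rw [Fin.sum_univ_four]
      push_cast
      simp only [← Complex.mul_conj]
      simp only [map_add, map_sub, map_mul, map_div₀, map_one, map_ofNat]
      generalize (starRingEnd ℂ) (x 0) = y0
      generalize (starRingEnd ℂ) (x 1) = y1
      generalize (starRingEnd ℂ) (x 2) = y2
      generalize (starRingEnd ℂ) (x 3) = y3
      generalize (starRingEnd ℂ) e = e' at *
      generalize (starRingEnd ℂ) f = f' at *
      linear_combination (-(8 / 3) * x 1 * y1 - (8 / 3) * x 3 * y3) * hee +
        (-(8 / 3) * x 2 * y2 - (8 / 3) * x 3 * y3) * hff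
    have h := Complex.normSq_nonneg
    linarith [h (x 0 + x 1), h (x 0 + e * x 1), h (x 0 + x 2), h (x 0 + f * x 2),
      h (x 1 + (1 + f) / 2 * x 3), h (x 2 + (1 + e) / 2 * x 3), h ((1 - f) * x 3),
      h ((1 - e) * x 3)]

theorem symbolP2_continuous : Continuous symbolP2 := by
  unfold symbolP2
  refine continuous_matrix fun i j => ?_
  fin_cases i <;> fin_cases j <;> simp <;> fun_prop

/-- `det (f - λ)` is real for real `λ`. -/
theorem symbolP2_det_im (θ : ℝ × ℝ) (t : ℝ) :
    (Matrix.det (symbolP2 θ - Matrix.scalar (Fin 4) (t : ℂ))).im = 0 := by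
  have hH : (symbolP2 θ - Matrix.scalar (Fin 4) (t : ℂ)).conjTranspose =
      symbolP2 θ - Matrix.scalar (Fin 4) (t : ℂ) := by
    ext i j
    fin_cases i <;> fin_cases j <;>
      simp [symbolP2, Matrix.conjTranspose_apply, ← Complex.exp_conj, ← Complex.cos_conj]
  rw [← Complex.conj_eq_iff_im, ← Matrix.star_eq_conjTranspose] at *
  conv_rhs => rw [← hH]
  rw [Matrix.star_eq_conjTranspose, Matrix.det_conjTranspose]
  rfl

/-- Here the eigenvalues are `0`, `16/3` (twice) and `32/3`: both ends of the range are attained,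
and the determinant is nonpositive in between. -/
theorem symbolP2_det_zero_zero (t : ℝ) :
    Matrix.det (symbolP2 (0, 0) - Matrix.scalar (Fin 4) (t : ℂ)) =
      ((t * (t - 16 / 3) ^ 2 * (t - 32 / 3) : ℝ) : ℂ) := by
  rw [Matrix.det_succ_row_zero]
  simp [Fin.sum_univ_succ, Matrix.det_fin_three, symbolP2, Fin.succAbove]
  ring

/-- Supplies the opposite sign for `t` outside `(8/3, 16/3)`. -/
theorem symbolP2_det_pi_pi (t : ℝ) :
    Matrix.det (symbolP2 (π, π) - Matrix.scalar (Fin 4) (t : ℂ)) =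
      (((16 / 3 - t) ^ 3 * (8 / 3 - t) : ℝ) : ℂ) := by
  have h1 : Complex.exp (Complex.I * π) = -1 := by rw [mul_comm, Complex.exp_pi_mul_I]
  have h2 : Complex.exp (-(Complex.I * π)) = -1 := by rw [Complex.exp_neg, h1]; norm_num
  rw [Matrix.det_succ_row_zero]
  simp [Fin.sum_univ_succ, Matrix.det_fin_three, symbolP2, Fin.succAbove, h1, h2]
  ring

/-- Supplies the opposite sign on the gap `[8/3, 16/3]`, which lies strictly between the roots `(14
± √68)/3` of the quadratic factor. -/
theorem symbolP2_det_pi_zero (t : ℝ) :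
    Matrix.det (symbolP2 (π, 0) - Matrix.scalar (Fin 4) (t : ℂ)) =
      (((t - 8 / 3) * (t - 8) * (t ^ 2 - 28 / 3 * t + 128 / 9) : ℝ) : ℂ) := by
  have h1 : Complex.exp (Complex.I * π) = -1 := by rw [mul_comm, Complex.exp_pi_mul_I]
  have h2 : Complex.exp (-(Complex.I * π)) = -1 := by rw [Complex.exp_neg, h1]; norm_num
  rw [Matrix.det_succ_row_zero]
  simp [Fin.sum_univ_succ, Matrix.det_fin_three, symbolP2, Fin.succAbove, h1, h2]
  ring

/-- The range of the eigenvalue functions of the symbol is the interval `[0, 32/3]`. -/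
theorem eigenvalueRange_symbolP2 :
    eigenvalueRange symbolP2 torusSquare = ((↑) : ℝ → ℂ) '' Set.Icc 0 (32 / 3) := by
  apply Set.Subset.antisymm
  · rintro z ⟨θ, -, hz⟩
    exact spectrum_subset_Icc_of_quadForm _ _ (symbolP2_quadForm θ) hz
  · rintro _ ⟨t, ⟨ht0, ht1⟩, rfl⟩
    set D : ℝ × ℝ → ℝ := fun θ => (Matrix.det (symbolP2 θ - Matrix.scalar (Fin 4) (t : ℂ))).re
      with hD
    have hDc : Continuous D :=
      Complex.continuous_re.comp (symbolP2_continuous.sub continuous_const).matrix_det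
    have hpre : IsPreconnected torusSquare := isPreconnected_Icc.prod isPreconnected_Icc
    have hpi := Real.pi_pos
    have h00 : ((0, 0) : ℝ × ℝ) ∈ torusSquare := ⟨⟨by simp; linarith, by simp; linarith⟩,
      ⟨by simp; linarith, by simp; linarith⟩⟩
    have hpp : ((π, π) : ℝ × ℝ) ∈ torusSquare := ⟨⟨by simp; linarith, by simp⟩,
      ⟨by simp; linarith, by simp⟩⟩
    have hp0 : ((π, 0) : ℝ × ℝ) ∈ torusSquare := ⟨⟨by simp; linarith, by simp⟩,
      ⟨by simp; linarith, by simp; linarith⟩⟩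
    have hD0 : D (0, 0) ≤ 0 := by
      simp only [hD, symbolP2_det_zero_zero, Complex.ofReal_re]
      exact mul_nonpos_of_nonneg_of_nonpos (by positivity) (by linarith)
    obtain ⟨θ₁, hθ₁, hD1⟩ : ∃ θ ∈ torusSquare, 0 ≤ D θ := by
      by_cases h1 : t ≤ 8 / 3
      · refine ⟨_, hpp, ?_⟩
        simp only [hD, symbolP2_det_pi_pi, Complex.ofReal_re]
        exact mul_nonneg (pow_nonneg (by linarith) 3) (by linarith)
      by_cases h2 : t ≤ 16 / 3
      · refine ⟨_, hp0, ?_⟩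
        simp only [hD, symbolP2_det_pi_zero, Complex.ofReal_re]
        push Not at h1
        exact mul_nonneg_of_nonpos_of_nonpos
          (mul_nonpos_of_nonneg_of_nonpos (by linarith) (by linarith)) (by nlinarith)
      · push Not at h1 h2
        refine ⟨_, hpp, ?_⟩
        simp only [hD, symbolP2_det_pi_pi, Complex.ofReal_re]
        exact mul_nonneg_of_nonpos_of_nonpos (Odd.pow_nonpos (by decide) (by linarith))
          (by linarith)
    obtain ⟨θ, hθ, h⟩ := hpre.intermediate_value h00 hθ₁ hDc.continuousOn ⟨hD0, hD1⟩
    refine ⟨θ, hθ, ?_⟩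
    have hdet : Matrix.det (symbolP2 θ - Matrix.scalar (Fin 4) (t : ℂ)) = 0 :=
      Complex.ext h (symbolP2_det_im θ t)
    rw [spectrum.mem_iff, ← IsUnit.neg_iff, neg_sub, Matrix.isUnit_iff_isUnit_det,
      isUnit_iff_ne_zero, not_not]
    exact hdet

/-! ### Block Toeplitz matrices -/

/-- The vector of trigonometric polynomials with coefficients `x`. -/
noncomputable def trigVector {r : Type*} {n₁ n₂ : ℕ} (x : (Fin n₁ × Fin n₂) × r → ℂ) (θ : ℝ × ℝ)
    (b : r) : ℂ :=
  ∑ J : Fin n₁ × Fin n₂, x (J, b) *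
    Complex.exp (Complex.I * (((J.1 : ℕ) : ℂ) * (θ.1 : ℂ) + ((J.2 : ℕ) : ℂ) * (θ.2 : ℂ)))

theorem trigVector_continuous {r : Type*} {n₁ n₂ : ℕ} (x : (Fin n₁ × Fin n₂) × r → ℂ) :
    Continuous (trigVector x) := by
  unfold trigVector
  fun_prop

theorem integrableOn_torusSquare {E : Type*} [NormedAddCommGroup E] {f : ℝ × ℝ → E}
    (hf : Continuous f) : IntegrableOn f torusSquare :=
  hf.continuousOn.integrableOn_compact (isCompact_Icc.prod isCompact_Icc)

/-- The quadratic form of a block Toeplitz matrix is the mean of the quadratic form of its symbol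
at a vector of trigonometric polynomials. -/
theorem blockToeplitz_quadForm {r : Type*} [Fintype r] (n₁ n₂ : ℕ) (f : ℝ × ℝ → Matrix r r ℂ)
    (hf : Continuous f) (x : (Fin n₁ × Fin n₂) × r → ℂ) :
    star x ⬝ᵥ (blockToeplitz n₁ n₂ f).mulVec x = (1 / (2 * (π : ℂ)) ^ 2) *
      ∫ θ in torusSquare, star (trigVector x θ) ⬝ᵥ (f θ).mulVec (trigVector x θ) := by
  set E : Fin n₁ × Fin n₂ → ℝ × ℝ → ℂ := fun J θ =>
    Complex.exp (Complex.I * (((J.1 : ℕ) : ℂ) * (θ.1 : ℂ) + ((J.2 : ℕ) : ℂ) * (θ.2 : ℂ))) with hE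
  have hEc : ∀ J, Continuous (E J) := fun J => by simp only [hE]; fun_prop
  have hfab : ∀ a b, Continuous fun θ => f θ a b := fun a b => hf.matrix_elem a b
  have hpt : ∀ θ, star (trigVector x θ) ⬝ᵥ (f θ).mulVec (trigVector x θ) =
      ∑ I : (Fin n₁ × Fin n₂) × r, ∑ J : (Fin n₁ × Fin n₂) × r,
        star (x I) * x J * (f θ I.2 J.2 * (star (E I.1 θ) * E J.1 θ)) := by
    intro θ
    have h1 : ∀ b, trigVector x θ b = ∑ J, x (J, b) * E J θ := fun b => rfl
    have hs : ∀ g : (Fin n₁ × Fin n₂) × r → ℂ, ∑ I, g I = ∑ a, ∑ I, g (I, a) :=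
      fun g => Fintype.sum_prod_type_right g
    simp only [dotProduct, Matrix.mulVec, Pi.star_apply, h1, star_sum, star_mul', hs,
      Finset.sum_mul, Finset.mul_sum]
    refine Finset.sum_congr rfl fun a _ => ?_
    conv_rhs => rw [Finset.sum_comm]
    refine Finset.sum_congr rfl fun b _ => ?_
    rw [Finset.sum_comm]
    refine Finset.sum_congr rfl fun I _ => Finset.sum_congr rfl fun J _ => ?_
    ring
  simp only [hpt]
  rw [integral_finsetSum _ fun I _ => ?_]
  swap
  · exact integrableOn_torusSquare (by fun_prop)
  simp only [dotProduct, Matrix.mulVec, Finset.mul_sum, Pi.star_apply]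
  refine Finset.sum_congr rfl fun I _ => ?_
  rw [integral_finsetSum _ fun J _ => ?_, Finset.mul_sum]
  swap
  · exact integrableOn_torusSquare (by fun_prop)
  refine Finset.sum_congr rfl fun J _ => ?_
  rw [integral_const_mul, blockToeplitz, Matrix.of_apply, fourierBlock, Matrix.of_apply]
  -- Conjugating the row exponential produces the frequency `-(I - J)`, which is the kernel of the
  -- Fourier coefficient of index `I - J`.
  have hexp : ∀ θ : ℝ × ℝ, star (E I.1 θ) * E J.1 θ = Complex.exp (-Complex.I *
      (((((I.1.1 : ℕ) : ℤ) - ((J.1.1 : ℕ) : ℤ) : ℤ) : ℂ) * (θ.1 : ℂ) +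
        ((((I.1.2 : ℕ) : ℤ) - ((J.1.2 : ℕ) : ℤ) : ℤ) : ℂ) * (θ.2 : ℂ))) := by
    intro θ
    rw [hE, RCLike.star_def, ← Complex.exp_conj, ← Complex.exp_add]
    congr 1
    simp
    ring
  simp only [hexp]
  ring

theorem integral_exp_int_mul (k : ℤ) :
    ∫ t in Set.Icc (-π) π, Complex.exp (-Complex.I * ((k : ℂ) * (t : ℂ))) =
      if k = 0 then 2 * (π : ℂ) else 0 := by
  rw [integral_Icc_eq_integral_Ioc, ← intervalIntegral.integral_of_le (by linarith [Real.pi_pos])]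
  split_ifs with hk
  · simp [hk]
    ring
  · have hc : -Complex.I * (k : ℂ) ≠ 0 := by simp [hk]
    simp only [← mul_assoc]
    rw [integral_exp_mul_complex hc, div_eq_zero_iff, sub_eq_zero]
    left
    -- The exponents at `π` and `-π` differ by `-k · 2πi`.
    rw [Complex.exp_eq_exp_iff_exists_int]
    refine ⟨-k, ?_⟩
    push_cast
    ring

/-- Orthogonality of the exponentials. Inserted into `blockToeplitz_quadForm` with the constant
symbol `1`, it becomes Parseval's identity for `trigVector`. -/
theorem blockToeplitz_one {r : Type*} [Fintype r] [DecidableEq r] (n₁ n₂ : ℕ) :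
    blockToeplitz n₁ n₂ (fun _ => (1 : Matrix r r ℂ)) = 1 := by
  have hpi : (π : ℂ) ≠ 0 := by exact_mod_cast Real.pi_ne_zero
  have hF : ∀ (k : ℤ × ℤ) (a b : r), fourierBlock (fun _ => (1 : Matrix r r ℂ)) k a b =
      if k.1 = 0 ∧ k.2 = 0 ∧ a = b then 1 else 0 := by
    intro k a b
    have hint : ∫ θ in torusSquare, Complex.exp (-Complex.I *
        ((k.1 : ℂ) * (θ.1 : ℂ) + (k.2 : ℂ) * (θ.2 : ℂ))) =
        (if k.1 = 0 then 2 * (π : ℂ) else 0) * (if k.2 = 0 then 2 * (π : ℂ) else 0) := by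
      simp only [mul_add, Complex.exp_add]
      rw [torusSquare, Measure.volume_eq_prod, setIntegral_prod_mul
        (fun t : ℝ => Complex.exp (-Complex.I * ((k.1 : ℂ) * (t : ℂ))))
        (fun t : ℝ => Complex.exp (-Complex.I * ((k.2 : ℂ) * (t : ℂ)))),
        integral_exp_int_mul, integral_exp_int_mul]
    rw [fourierBlock, Matrix.of_apply, integral_const_mul, hint, Matrix.one_apply]
    by_cases h1 : k.1 = 0 <;> by_cases h2 : k.2 = 0 <;> by_cases h3 : a = b <;> simp [h1, h2, h3]
    field_simp
  ext I J
  rw [blockToeplitz, Matrix.of_apply, hF, Matrix.one_apply]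
  refine if_congr ?_ rfl rfl
  rw [Prod.ext_iff, Prod.ext_iff, Fin.ext_iff, Fin.ext_iff, sub_eq_zero, sub_eq_zero,
    Nat.cast_inj, Nat.cast_inj, and_assoc]

theorem star_dotProduct_self_eq_normSq {ι : Type*} [Fintype ι] (z : ι → ℂ) :
    star z ⬝ᵥ z = ((∑ i, Complex.normSq (z i) : ℝ) : ℂ) := by
  simp only [dotProduct, Pi.star_apply, Complex.ofReal_sum]
  exact Finset.sum_congr rfl fun i _ => Complex.normSq_eq_conj_mul_self.symm

/-- If the quadratic form of a continuous symbol lies between `0` and `c`, then the eigenvalues of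
the block Toeplitz matrices it generates lie in `[0, c]`. -/
theorem spectrum_blockToeplitz_subset {r : Type*} [Fintype r] [DecidableEq r] (n₁ n₂ : ℕ)
    (f : ℝ × ℝ → Matrix r r ℂ) (hf : Continuous f) (c : ℝ)
    (h : ∀ θ, ∀ x : r → ℂ, ∃ q : ℝ, star x ⬝ᵥ (f θ).mulVec x = (q : ℂ) ∧ 0 ≤ q ∧
      q ≤ c * ∑ i, Complex.normSq (x i)) :
    spectrum ℂ (blockToeplitz n₁ n₂ f) ⊆ ((↑) : ℝ → ℂ) '' Set.Icc 0 c := by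
  refine spectrum_subset_Icc_of_quadForm _ c fun x => ?_
  choose q hq hq0 hqc using fun θ => h θ (trigVector x θ)
  have hyc := trigVector_continuous x
  have hyb : ∀ b, Continuous fun θ => trigVector x θ b := fun b => (continuous_apply b).comp hyc
  have hqcont : Continuous q := by
    -- The values `q θ` are chosen pointwise; they are determined as the real part of a continuous
    -- function, hence integrable on the square.
    have : q = fun θ => (star (trigVector x θ) ⬝ᵥ (f θ).mulVec (trigVector x θ)).re := by
      funext θ
      rw [hq, Complex.ofReal_re]
    rw [this]
    exact Complex.continuous_re.comp (hyc.star.dotProduct (hf.matrix_mulVec hyc))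
  have hN : Continuous fun θ => ∑ b, Complex.normSq (trigVector x θ b) :=
    continuous_finsetSum _ fun b _ => Complex.continuous_normSq.comp (hyb b)
  have hpars : ∑ I, Complex.normSq (x I) = 1 / (2 * π) ^ 2 *
      ∫ θ in torusSquare, ∑ b, Complex.normSq (trigVector x θ b) := by
    have h1 := blockToeplitz_quadForm n₁ n₂ (fun _ => (1 : Matrix r r ℂ)) continuous_const x
    rw [blockToeplitz_one] at h1
    simp only [Matrix.one_mulVec] at h1
    simp only [star_dotProduct_self_eq_normSq] at h1
    rw [integral_complex_ofReal] at h1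
    exact_mod_cast h1
  refine ⟨1 / (2 * π) ^ 2 * ∫ θ in torusSquare, q θ, ?_, ?_, ?_⟩
  · rw [blockToeplitz_quadForm n₁ n₂ f hf x]
    simp only [hq]
    rw [integral_complex_ofReal]
    push_cast
    rfl
  · exact mul_nonneg (by positivity) (integral_nonneg fun θ => hq0 θ)
  · rw [hpars, mul_left_comm, ← integral_const_mul c]
    refine mul_le_mul_of_nonneg_left (integral_mono (integrableOn_torusSquare hqcont)
      (integrableOn_torusSquare (continuous_const.mul hN)) hqc) (by positivity)

/-! ### Dirichlet energy on the reference triangle -/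

/-- The open reference triangle. -/
def refTriangle : Set (ℝ × ℝ) := {p | 0 < p.1 ∧ 0 < p.2 ∧ p.1 + p.2 < 1}

theorem isOpen_refTriangle : IsOpen refTriangle :=
  (isOpen_lt continuous_const continuous_fst).inter
    ((isOpen_lt continuous_const continuous_snd).inter
      (isOpen_lt (continuous_fst.add continuous_snd) continuous_const))

theorem integrableOn_refTriangle {g : ℝ × ℝ → ℝ} (hg : Continuous g) :
    IntegrableOn g refTriangle :=
  (hg.continuousOn.integrableOn_compact
    (isCompact_Icc (a := ((0, 0) : ℝ × ℝ)) (b := (1, 1)))).mono_set fun p hp =>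
      ⟨⟨hp.1.le, hp.2.1.le⟩, ⟨by linarith [hp.2.1, hp.2.2], by linarith [hp.1, hp.2.2]⟩⟩

theorem setIntegral_refTriangle {g : ℝ × ℝ → ℝ} (hg : Continuous g) :
    ∫ p in refTriangle, g p = ∫ s in (0 : ℝ)..1, ∫ t in (0 : ℝ)..(1 - s), g (s, t) := by
  have hm := isOpen_refTriangle.measurableSet
  rw [← integral_indicator hm, Measure.volume_eq_prod, integral_prod _
    ((integrable_indicator_iff hm).2 (integrableOn_refTriangle hg)),
    intervalIntegral.integral_of_le zero_le_one, integral_Ioc_eq_integral_Ioo,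
    ← integral_indicator measurableSet_Ioo]
  congr 1
  funext s
  by_cases hs : s ∈ Set.Ioo (0 : ℝ) 1
  · rw [Set.indicator_of_mem hs, intervalIntegral.integral_of_le (by linarith [hs.2]),
      integral_Ioc_eq_integral_Ioo, ← integral_indicator measurableSet_Ioo]
    congr 1
    funext t
    refine Set.indicator_eq_indicator ?_ rfl
    simp only [refTriangle, Set.mem_ofPred_eq, Set.mem_Ioo, hs.1, true_and]
    exact and_congr_right fun _ => ⟨fun h => by linarith, fun h => by linarith⟩
  · rw [Set.indicator_of_notMem hs]
    refine integral_eq_zero_of_ae (Eventually.of_forall fun t => Set.indicator_of_notMem ?_ _)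
    exact fun h => hs ⟨h.1, by linarith [h.2.1, h.2.2]⟩

/-- The partial derivatives of a quadratic polynomial are affine, so its energy is a sum of two such
integrals. -/
theorem setIntegral_refTriangle_affine_sq (A B C : ℝ) :
    ∫ p in refTriangle, (A + B * p.1 + C * p.2) ^ 2 =
      A ^ 2 / 2 + (B ^ 2 + C ^ 2) / 12 + (A * B + A * C) / 3 + B * C / 12 := by
  rw [setIntegral_refTriangle (by fun_prop)]
  have h1 : ∀ s : ℝ, ∫ t in (0 : ℝ)..(1 - s), (A + B * s + C * t) ^ 2 =
      (A + B * s) ^ 2 * (1 - s) + (A + B * s) * C * (1 - s) ^ 2 + C ^ 2 / 3 * (1 - s) ^ 3 := by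
    intro s
    have hd : ∀ t ∈ Set.uIcc 0 (1 - s), HasDerivAt
        (fun t : ℝ => (A + B * s) ^ 2 * t + (A + B * s) * C * t ^ 2 + C ^ 2 / 3 * t ^ 3)
        ((A + B * s + C * t) ^ 2) t := by
      intro t _
      refine ((((hasDerivAt_id' t).const_mul ((A + B * s) ^ 2)).add
        ((hasDerivAt_pow 2 t).const_mul ((A + B * s) * C))).add
        ((hasDerivAt_pow 3 t).const_mul (C ^ 2 / 3))).congr_deriv ?_
      push_cast
      ring
    rw [intervalIntegral.integral_eq_sub_of_hasDerivAt hd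
      (Continuous.intervalIntegrable (by fun_prop) _ _)]
    ring
  simp only [h1]
  have hd : ∀ s ∈ Set.uIcc (0 : ℝ) 1, HasDerivAt
      (fun s : ℝ => (A ^ 2 + A * C + C ^ 2 / 3) * s +
        (2 * A * B - A ^ 2 + B * C - 2 * A * C - C ^ 2) / 2 * s ^ 2 +
        (B ^ 2 - 2 * A * B + A * C - 2 * B * C + C ^ 2) / 3 * s ^ 3 +
        (-B ^ 2 + B * C - C ^ 2 / 3) / 4 * s ^ 4)
      ((A + B * s) ^ 2 * (1 - s) + (A + B * s) * C * (1 - s) ^ 2 + C ^ 2 / 3 * (1 - s) ^ 3) s := by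
    intro s _
    refine (((((hasDerivAt_id' s).const_mul (A ^ 2 + A * C + C ^ 2 / 3)).add
      ((hasDerivAt_pow 2 s).const_mul
        ((2 * A * B - A ^ 2 + B * C - 2 * A * C - C ^ 2) / 2))).add
      ((hasDerivAt_pow 3 s).const_mul
        ((B ^ 2 - 2 * A * B + A * C - 2 * B * C + C ^ 2) / 3))).add
      ((hasDerivAt_pow 4 s).const_mul ((-B ^ 2 + B * C - C ^ 2 / 3) / 4))).congr_deriv ?_
    push_cast
    ring
  rw [intervalIntegral.integral_eq_sub_of_hasDerivAt hd
    (Continuous.intervalIntegrable (by fun_prop) _ _)]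
  ring

/-- The quadratic polynomial in two variables with coefficients `k`. -/
def quad (k : Fin 6 → ℝ) (p : ℝ × ℝ) : ℝ :=
  k 0 + k 1 * p.1 + k 2 * p.2 + k 3 * p.1 ^ 2 + k 4 * (p.1 * p.2) + k 5 * p.2 ^ 2

/-- The first partial derivative of `quad k`. -/
def quadX (k : Fin 6 → ℝ) (p : ℝ × ℝ) : ℝ := k 1 + 2 * k 3 * p.1 + k 4 * p.2

/-- The second partial derivative of `quad k`. -/
def quadY (k : Fin 6 → ℝ) (p : ℝ × ℝ) : ℝ := k 2 + k 4 * p.1 + 2 * k 5 * p.2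

theorem quadX_continuous (k : Fin 6 → ℝ) : Continuous (quadX k) := by
  unfold quadX
  fun_prop

theorem quadY_continuous (k : Fin 6 → ℝ) : Continuous (quadY k) := by
  unfold quadY
  fun_prop

theorem quad_sum {ι : Type*} [Fintype ι] (x : ι → ℝ) (k : ι → Fin 6 → ℝ) (p : ℝ × ℝ) :
    quad (∑ i, x i • k i) p = ∑ i, x i * quad (k i) p := by
  simp only [quad, Finset.sum_apply, Pi.smul_apply, smul_eq_mul, mul_add, Finset.sum_add_distrib,
    Finset.sum_mul, ← mul_assoc]

theorem quadX_sum {ι : Type*} [Fintype ι] (x : ι → ℝ) (k : ι → Fin 6 → ℝ) (p : ℝ × ℝ) :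
    quadX (∑ i, x i • k i) p = ∑ i, x i * quadX (k i) p := by
  simp only [quadX, Finset.sum_apply, Pi.smul_apply, smul_eq_mul, mul_add, Finset.sum_add_distrib,
    Finset.sum_mul, ← mul_assoc, mul_comm (2 : ℝ)]

theorem quadY_sum {ι : Type*} [Fintype ι] (x : ι → ℝ) (k : ι → Fin 6 → ℝ) (p : ℝ × ℝ) :
    quadY (∑ i, x i • k i) p = ∑ i, x i * quadY (k i) p := by
  simp only [quadY, Finset.sum_apply, Pi.smul_apply, smul_eq_mul, mul_add, Finset.sum_add_distrib,
    Finset.sum_mul, ← mul_assoc, mul_comm (2 : ℝ)]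

/-- The Dirichlet form of two quadratic polynomials on the reference triangle. -/
noncomputable def refEnergy (k l : Fin 6 → ℝ) : ℝ :=
  ∫ p in refTriangle, (quadX k p * quadX l p + quadY k p * quadY l p)

theorem refEnergy_self_nonneg (k : Fin 6 → ℝ) : 0 ≤ refEnergy k k :=
  integral_nonneg fun _ => add_nonneg (mul_self_nonneg _) (mul_self_nonneg _)

/-- Bilinearity of the energy: summed over the triangles, the right-hand side becomes the quadratic
form of the assembled stiffness matrix. -/
theorem refEnergy_sum {ι : Type*} [Fintype ι] (x : ι → ℝ) (k : ι → Fin 6 → ℝ) :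
    refEnergy (∑ i, x i • k i) (∑ i, x i • k i) = ∑ i, ∑ j, x i * refEnergy (k j) (k i) * x j := by
  have hX := fun i => quadX_continuous (k i)
  have hY := fun i => quadY_continuous (k i)
  have hpt : ∀ p, quadX (∑ i, x i • k i) p * quadX (∑ i, x i • k i) p +
      quadY (∑ i, x i • k i) p * quadY (∑ i, x i • k i) p =
      ∑ i, ∑ j, x i * x j * (quadX (k j) p * quadX (k i) p + quadY (k j) p * quadY (k i) p) := by
    intro p
    rw [quadX_sum, quadY_sum, Finset.sum_mul_sum, Finset.sum_mul_sum, ← Finset.sum_add_distrib]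
    refine Finset.sum_congr rfl fun i _ => ?_
    rw [← Finset.sum_add_distrib]
    refine Finset.sum_congr rfl fun j _ => ?_
    ring
  rw [refEnergy]
  simp only [hpt]
  rw [integral_finsetSum _ fun i _ => integrableOn_refTriangle (by fun_prop)]
  refine Finset.sum_congr rfl fun i _ => ?_
  rw [integral_finsetSum _ fun j _ => integrableOn_refTriangle (by fun_prop)]
  refine Finset.sum_congr rfl fun j _ => ?_
  rw [integral_const_mul, ← refEnergy]
  ring

/-- The Dirichlet energy of a quadratic polynomial on the reference triangle, bounded by the nodal
values weighted with the absolute row sums of the element stiffness matrix. -/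
theorem refEnergy_self_le (k : Fin 6 → ℝ) :
    refEnergy k k ≤ 8 / 3 * quad k (0, 0) ^ 2 +
      4 / 3 * (quad k (1, 0) ^ 2 + quad k (0, 1) ^ 2) +
      16 / 3 * (quad k (1 / 2, 0) ^ 2 + quad k (0, 1 / 2) ^ 2 + quad k (1 / 2, 1 / 2) ^ 2) := by
  have hX := quadX_continuous k
  have hY := quadY_continuous k
  rw [refEnergy, integral_add (integrableOn_refTriangle (by fun_prop))
    (integrableOn_refTriangle (by fun_prop))]
  simp only [← sq]
  have h1 := setIntegral_refTriangle_affine_sq (k 1) (2 * k 3) (k 4)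
  have h2 := setIntegral_refTriangle_affine_sq (k 2) (k 4) (2 * k 5)
  simp only [quadX, quadY]
  rw [h1, h2]
  -- For a leg with end values `v₀`, `v₁` and midpoint value `m`, the Gershgorin defect `(v₀-v₁)²/6
  -- + 2/3 (v₀+m)² + 2/3 (v₁+m)²` is one sixth of this expression. The midpoint of the hypotenuse is
  -- coupled, with entry `-4/3`, only to the other two midpoints; this gives `e3` and `e4`.
  have key := fun v₀ v₁ m : ℝ => add_nonneg (mul_nonneg (zero_le_two) (sq_nonneg (2 * m + v₀ + v₁)))
    (mul_nonneg zero_le_three (sq_nonneg (v₀ - v₁)))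
  have e1 := key (quad k (0, 0)) (quad k (1, 0)) (quad k (1 / 2, 0))
  have e2 := key (quad k (0, 0)) (quad k (0, 1)) (quad k (0, 1 / 2))
  have e3 := sq_nonneg (quad k (1 / 2, 1 / 2) + quad k (0, 1 / 2))
  have e4 := sq_nonneg (quad k (1 / 2, 1 / 2) + quad k (1 / 2, 0))
  simp only [quad] at *
  linarith

/-- Change of variables in the plane: a dilation by `c` has Jacobian `c²`, for either sign of `c`.
-/
theorem setIntegral_refTriangle_comp (c d e : ℝ) (g : ℝ × ℝ → ℝ) :
    ∫ x in (fun x : ℝ × ℝ => (c * x.1 - d, c * x.2 - e)) ⁻¹' refTriangle,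
      g (c * x.1 - d, c * x.2 - e) = (c ^ 2)⁻¹ * ∫ p in refTriangle, g p := by
  have hm := isOpen_refTriangle.measurableSet
  have hm' : MeasurableSet ((fun x : ℝ × ℝ => (c * x.1 - d, c * x.2 - e)) ⁻¹' refTriangle) :=
    (isOpen_refTriangle.preimage (by fun_prop)).measurableSet
  rw [← integral_indicator hm', ← integral_indicator hm]
  have h1 : ∀ x : ℝ × ℝ, ((fun x : ℝ × ℝ => (c * x.1 - d, c * x.2 - e)) ⁻¹' refTriangle).indicator
      (fun x => g (c * x.1 - d, c * x.2 - e)) x =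
      (fun y => refTriangle.indicator g (y - (d, e))) (c • x) := fun x => rfl
  simp only [h1]
  rw [Measure.integral_comp_smul volume (fun y => refTriangle.indicator g (y - (d, e))),
    integral_sub_right_eq_self (refTriangle.indicator g) ((d, e) : ℝ × ℝ)]
  simp

/-! ### The triangles of the mesh -/

/-- The cells of the mesh of step `1/n`, each with a flag for its upper triangle. -/
abbrev TriIndex (n : ℕ) : Type := Fin n × Fin n × Bool

/-- The linear part of the affine map from a triangle of the mesh to the reference triangle is the
multiplication by this number. -/
def triScale (n : ℕ) (σ : Bool) : ℝ := bif σ then -n else n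

/-- The translation part of the affine map from a triangle of the mesh to the reference
triangle. -/
def triShift (σ : Bool) (a : ℕ) : ℝ := bif σ then -(a + 1) else a

/-- The affine map from a triangle of the mesh to the reference triangle. -/
def triMap (n : ℕ) (k : TriIndex n) (x : ℝ × ℝ) : ℝ × ℝ :=
  (triScale n k.2.2 * x.1 - triShift k.2.2 k.1, triScale n k.2.2 * x.2 - triShift k.2.2 k.2.1)

/-- The open triangles of the mesh. -/
def meshTri (n : ℕ) (k : TriIndex n) : Set (ℝ × ℝ) := triMap n k ⁻¹' refTriangle

theorem triScale_ne_zero {n : ℕ} (k : TriIndex n) : triScale n k.2.2 ≠ 0 := by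
  have : (n : ℝ) ≠ 0 := Nat.cast_ne_zero.2 k.1.pos.ne'
  obtain ⟨a, b, _ | _⟩ := k <;> simpa [triScale] using this

theorem isOpen_meshTri (n : ℕ) (k : TriIndex n) : IsOpen (meshTri n k) :=
  isOpen_refTriangle.preimage (by unfold triMap; fun_prop)

theorem setOf_triMap_mem_fkMesh (n : ℕ) (k : TriIndex n) :
    {x | 0 ≤ (triMap n k x).1 ∧ 0 ≤ (triMap n k x).2 ∧
      (triMap n k x).1 + (triMap n k x).2 ≤ 1} ∈ fkMesh n := by
  obtain ⟨a, b, _ | _⟩ := k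
  · refine ⟨a, b, Or.inl ?_⟩
    ext x
    simp only [triMap, triScale, triShift, cond_false, Set.mem_ofPred_eq]
    exact and_congr (by rw [sub_nonneg]) (and_congr (by rw [sub_nonneg])
      ⟨fun h => by linarith, fun h => by linarith⟩)
  · refine ⟨a, b, Or.inr ?_⟩
    ext x
    simp only [triMap, triScale, triShift, cond_true, Set.mem_ofPred_eq]
    exact and_congr ⟨fun h => by linarith, fun h => by linarith⟩
      (and_congr ⟨fun h => by linarith, fun h => by linarith⟩
      ⟨fun h => by linarith, fun h => by linarith⟩)

/-- The nodal basis functions are quadratic polynomials on each triangle of the mesh. -/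
theorem p2Basis_eq_quad (n : ℕ) (k : TriIndex n) (i : P2Index n) :
    ∃ q : Fin 6 → ℝ, ∀ x, 0 ≤ (triMap n k x).1 → 0 ≤ (triMap n k x).2 →
      (triMap n k x).1 + (triMap n k x).2 ≤ 1 → p2Basis n i x = quad q (triMap n k x) := by
  have hc := triScale_ne_zero k
  -- The inequalities are not strict because the polynomials are later evaluated at the nodes, which
  -- lie on the boundary of the triangle.
  have hat : ∀ p q : ℕ, ∃ A B C : ℝ, ∀ x, 0 ≤ (triMap n k x).1 → 0 ≤ (triMap n k x).2 →
      (triMap n k x).1 + (triMap n k x).2 ≤ 1 →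
      fkHat n p q x = A + B * (triMap n k x).1 + C * (triMap n k x).2 := by
    intro p q
    obtain ⟨c₀, c₁, c₂, h⟩ := fkHat_affine n p q _ (setOf_triMap_mem_fkMesh n k)
    refine ⟨c₀ + c₁ * (triShift k.2.2 k.1 / triScale n k.2.2) +
      c₂ * (triShift k.2.2 k.2.1 / triScale n k.2.2), c₁ / triScale n k.2.2,
      c₂ / triScale n k.2.2, fun x h1 h2 h3 => ?_⟩
    rw [h x ⟨h1, h2, h3⟩, triMap]
    field_simp
    ring
  unfold p2Basis
  dsimp only
  split_ifs
  · obtain ⟨A, B, C, h⟩ := hat (((i.1 : ℕ) + 1) / 2) (((i.2 : ℕ) + 1) / 2)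
    refine ⟨![A * (2 * A - 1), B * (4 * A - 1), C * (4 * A - 1), 2 * B ^ 2, 4 * B * C, 2 * C ^ 2],
      fun x h1 h2 h3 => ?_⟩
    rw [h x h1 h2 h3]
    simp only [quad, Matrix.cons_val]
    ring
  · obtain ⟨A, B, C, h⟩ := hat (((i.1 : ℕ) + 1) / 2) (((i.2 : ℕ) + 1 + 1) / 2)
    obtain ⟨A', B', C', h'⟩ := hat (((i.1 : ℕ) + 1 + 1) / 2) (((i.2 : ℕ) + 1) / 2)
    refine ⟨![4 * A * A', 4 * (A * B' + B * A'), 4 * (A * C' + C * A'), 4 * B * B',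
      4 * (B * C' + C * B'), 4 * C * C'], fun x h1 h2 h3 => ?_⟩
    rw [h x h1 h2 h3, h' x h1 h2 h3]
    simp only [quad, Matrix.cons_val]
    ring

theorem hasDerivAt_quad_fst (q : Fin 6 → ℝ) (c d e s t : ℝ) :
    HasDerivAt (fun s => quad q (c * s - d, c * t - e)) (c * quadX q (c * s - d, c * t - e)) s := by
  have h := ((hasDerivAt_id' s).const_mul c).sub_const d
  unfold quad quadX
  refine (((((h.const_mul (q 1)).const_add (q 0)).add_const (q 2 * (c * t - e))).add
    ((h.pow 2).const_mul (q 3))).add ((h.mul_const (c * t - e)).const_mul (q 4))).add_const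
    (q 5 * (c * t - e) ^ 2) |>.congr_deriv ?_
  push_cast
  ring

theorem hasDerivAt_quad_snd (q : Fin 6 → ℝ) (c d e s t : ℝ) :
    HasDerivAt (fun t => quad q (c * s - d, c * t - e)) (c * quadY q (c * s - d, c * t - e)) t := by
  have h := ((hasDerivAt_id' t).const_mul c).sub_const e
  unfold quad quadY
  refine ((((h.const_mul (q 2)).const_add (q 0 + q 1 * (c * s - d))).add_const
    (q 3 * (c * s - d) ^ 2)).add ((h.const_mul (c * s - d)).const_mul (q 4))).add
    ((h.pow 2).const_mul (q 5)) |>.congr_deriv ?_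
  push_cast
  ring

/-- The open triangle contains a neighbourhood of `x` on the horizontal line, so the derivative only
sees the polynomial piece; the chain rule contributes the scale. -/
theorem partialX_eq_of_quad {n : ℕ} {k : TriIndex n} {φ : ℝ × ℝ → ℝ} {q : Fin 6 → ℝ}
    (h : ∀ x ∈ meshTri n k, φ x = quad q (triMap n k x)) {x : ℝ × ℝ} (hx : x ∈ meshTri n k) :
    partialX φ x = triScale n k.2.2 * quadX q (triMap n k x) := by
  have hev : ∀ᶠ s in 𝓝 x.1, (s, x.2) ∈ meshTri n k :=
    ((Continuous.prodMk_left x.2).tendsto x.1).eventually ((isOpen_meshTri n k).mem_nhds hx)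
  exact ((hasDerivAt_quad_fst q _ _ _ x.1 x.2).congr_of_eventuallyEq
    (hev.mono fun s hs => h _ hs)).deriv

theorem partialY_eq_of_quad {n : ℕ} {k : TriIndex n} {φ : ℝ × ℝ → ℝ} {q : Fin 6 → ℝ}
    (h : ∀ x ∈ meshTri n k, φ x = quad q (triMap n k x)) {x : ℝ × ℝ} (hx : x ∈ meshTri n k) :
    partialY φ x = triScale n k.2.2 * quadY q (triMap n k x) := by
  have hev : ∀ᶠ t in 𝓝 x.2, (x.1, t) ∈ meshTri n k :=
    ((Continuous.prodMk_right x.1).tendsto x.2).eventually ((isOpen_meshTri n k).mem_nhds hx)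
  exact ((hasDerivAt_quad_snd q _ _ _ x.1 x.2).congr_of_eventuallyEq
    (hev.mono fun s hs => h _ hs)).deriv

/-- Both flags give the same bounds for the cell and differ only in the side of the diagonal;
disjointness and covering are read off from this form. -/
theorem meshTri_iff (n : ℕ) (a b : Fin n) (σ : Bool) (x : ℝ × ℝ) :
    x ∈ meshTri n (a, b, σ) ↔ (((a : ℕ) : ℝ) < n * x.1 ∧ n * x.1 < (a : ℕ) + 1) ∧
      (((b : ℕ) : ℝ) < n * x.2 ∧ n * x.2 < (b : ℕ) + 1) ∧
      bif σ then ((a : ℕ) : ℝ) + (b : ℕ) + 1 < n * x.1 + n * x.2 else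
        n * x.1 + n * x.2 < (a : ℕ) + (b : ℕ) + 1 := by
  cases σ
  · simp only [meshTri, refTriangle, triMap, triScale, triShift, cond_false, Set.mem_preimage,
      Set.mem_ofPred_eq]
    exact ⟨fun ⟨h1, h2, h3⟩ => ⟨⟨by linarith, by linarith⟩, ⟨by linarith, by linarith⟩,
      by linarith⟩, fun ⟨⟨h1, _⟩, ⟨h2, _⟩, h3⟩ => ⟨by linarith, by linarith, by linarith⟩⟩
  · simp only [meshTri, refTriangle, triMap, triScale, triShift, cond_true, Set.mem_preimage,
      Set.mem_ofPred_eq]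
    exact ⟨fun ⟨h1, h2, h3⟩ => ⟨⟨by linarith, by linarith⟩, ⟨by linarith, by linarith⟩,
      by linarith⟩, fun ⟨⟨_, h1⟩, ⟨_, h2⟩, h3⟩ => ⟨by linarith, by linarith, by linarith⟩⟩

theorem meshTri_subset_unitSquare (n : ℕ) (k : TriIndex n) : meshTri n k ⊆ unitSquare := by
  obtain ⟨a, b, σ⟩ := k
  intro x hx
  rw [meshTri_iff] at hx
  obtain ⟨⟨h1, h2⟩, ⟨h3, h4⟩, -⟩ := hx
  have hn : (0 : ℝ) < n := Nat.cast_pos.2 a.pos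
  have aux : ∀ (c : Fin n) (y : ℝ), ((c : ℕ) : ℝ) < n * y → n * y < (c : ℕ) + 1 →
      y ∈ Set.Ioo (0 : ℝ) 1 := by
    intro c y hy hy'
    have h0 : (0 : ℝ) ≤ (c : ℕ) := Nat.cast_nonneg _
    have h1 : ((c : ℕ) : ℝ) + 1 ≤ n := by exact_mod_cast c.isLt
    exact ⟨pos_of_mul_pos_right (h0.trans_lt hy) hn.le,
      lt_of_mul_lt_mul_left (by linarith) hn.le⟩
  exact ⟨aux a _ h1 h2, aux b _ h3 h4⟩

theorem pairwise_disjoint_meshTri (n : ℕ) :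
    Pairwise (Function.onFun Disjoint (meshTri n)) := by
  rintro ⟨a, b, σ⟩ ⟨a', b', σ'⟩ hne
  rw [Function.onFun, Set.disjoint_left]
  intro x hx hx'
  rw [meshTri_iff] at hx hx'
  obtain ⟨⟨h1, h2⟩, ⟨h3, h4⟩, h5⟩ := hx
  obtain ⟨⟨h1', h2'⟩, ⟨h3', h4'⟩, h5'⟩ := hx'
  have aux : ∀ (c c' : Fin n) (y : ℝ), ((c : ℕ) : ℝ) < y → y < (c : ℕ) + 1 →
      ((c' : ℕ) : ℝ) < y → y < (c' : ℕ) + 1 → c = c' := by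
    intro c c' y h1 h2 h3 h4
    have h5 : (c : ℕ) < (c' : ℕ) + 1 := by exact_mod_cast h1.trans h4
    have h6 : (c' : ℕ) < (c : ℕ) + 1 := by exact_mod_cast h3.trans h2
    exact Fin.ext (by omega)
  obtain rfl := aux a a' _ h1 h2 h1' h2'
  obtain rfl := aux b b' _ h3 h4 h3' h4'
  cases σ <;> cases σ' <;> simp only [cond_true, cond_false] at h5 h5'
  · exact hne rfl
  · exact lt_asymm h5 h5'
  · exact lt_asymm h5 h5'
  · exact hne rfl

/-- The open triangles of the mesh cover the unit square up to a null set. -/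
theorem unitSquare_ae_eq_iUnion_meshTri (n : ℕ) (hn : 0 < n) :
    unitSquare =ᵐ[volume] ⋃ k, meshTri n k := by
  have hn' : (0 : ℝ) < n := Nat.cast_pos.2 hn
  have hcount : (Set.range fun m : ℕ => (m : ℝ) / n).Countable := Set.countable_range _
  have h1 : ∀ᵐ x : ℝ × ℝ, x.1 ∉ Set.range fun m : ℕ => (m : ℝ) / n :=
    Measure.quasiMeasurePreserving_fst.ae (hcount.ae_notMem volume)
  have h2 : ∀ᵐ x : ℝ × ℝ, x.2 ∉ Set.range fun m : ℕ => (m : ℝ) / n :=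
    Measure.quasiMeasurePreserving_snd.ae (hcount.ae_notMem volume)
  -- The shear `(s, t) ↦ (s, s + t)` preserves the measure, so the diagonals are as negligible as
  -- the grid lines.
  have h3 : ∀ᵐ x : ℝ × ℝ, x.1 + x.2 ∉ Set.range fun m : ℕ => (m : ℝ) / n :=
    (Measure.quasiMeasurePreserving_snd.comp
      (measurePreserving_prod_add (volume : Measure ℝ) volume).quasiMeasurePreserving).ae
      (hcount.ae_notMem volume)
  filter_upwards [h1, h2, h3] with x hx1 hx2 hx3
  have hne : ∀ y : ℝ, (y ∉ Set.range fun m : ℕ => (m : ℝ) / n) → ∀ m : ℕ, n * y ≠ m := by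
    intro y hy m hm
    exact hy ⟨m, by rw [div_eq_iff hn'.ne', ← hm, mul_comm]⟩
  refine propext ⟨fun hx => ?_, fun hx => ?_⟩
  · obtain ⟨⟨hx10, hx11⟩, hx20, hx21⟩ := hx
    have hfl : ∀ y : ℝ, 0 < y → y < 1 → (y ∉ Set.range fun m : ℕ => (m : ℝ) / n) →
        ∃ c : Fin n, ((c : ℕ) : ℝ) < n * y ∧ n * y < (c : ℕ) + 1 := by
      intro y hy0 hy1 hy
      have h0 : 0 ≤ (n : ℝ) * y := by positivity
      refine ⟨⟨⌊(n : ℝ) * y⌋₊, (Nat.floor_lt h0).2 (by nlinarith)⟩,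
        lt_of_le_of_ne (Nat.floor_le h0) (hne y hy _).symm, Nat.lt_floor_add_one _⟩
    obtain ⟨a, ha, ha'⟩ := hfl _ hx10 hx11 hx1
    obtain ⟨b, hb, hb'⟩ := hfl _ hx20 hx21 hx2
    have h4 := hne _ hx3 (a + b + 1)
    push_cast at h4
    rw [mul_add] at h4
    refine Set.mem_iUnion.2 ?_
    rcases lt_or_gt_of_ne h4 with h | h
    · exact ⟨(a, b, false), (meshTri_iff ..).2 ⟨⟨ha, ha'⟩, ⟨hb, hb'⟩, h⟩⟩
    · exact ⟨(a, b, true), (meshTri_iff ..).2 ⟨⟨ha, ha'⟩, ⟨hb, hb'⟩, h⟩⟩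
  · obtain ⟨k, hk⟩ := Set.mem_iUnion.1 hx
    exact meshTri_subset_unitSquare n k hk

/-! ### Assembly of the stiffness matrix -/

/-- The Dirichlet integrand of two functions that are quadratic on a triangle of the mesh. -/
theorem dirichlet_meshTri {n : ℕ} {k : TriIndex n} {φ ψ : ℝ × ℝ → ℝ} {q l : Fin 6 → ℝ}
    (hφ : ∀ x ∈ meshTri n k, φ x = quad q (triMap n k x))
    (hψ : ∀ x ∈ meshTri n k, ψ x = quad l (triMap n k x)) :
    IntegrableOn (fun x => partialX φ x * partialX ψ x + partialY φ x * partialY ψ x)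
      (meshTri n k) ∧
    ∫ x in meshTri n k, (partialX φ x * partialX ψ x + partialY φ x * partialY ψ x) =
      refEnergy q l := by
  have hc := triScale_ne_zero k
  have hm := (isOpen_meshTri n k).measurableSet
  have hpt : ∀ x ∈ meshTri n k, partialX φ x * partialX ψ x + partialY φ x * partialY ψ x =
      triScale n k.2.2 ^ 2 * (quadX q (triMap n k x) * quadX l (triMap n k x) +
        quadY q (triMap n k x) * quadY l (triMap n k x)) := by
    intro x hx
    rw [partialX_eq_of_quad hφ hx, partialX_eq_of_quad hψ hx, partialY_eq_of_quad hφ hx,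
      partialY_eq_of_quad hψ hx]
    ring
  constructor
  · rw [integrableOn_congr_fun hpt hm]
    refine IntegrableOn.mono_set (ContinuousOn.integrableOn_compact
      (isCompact_Icc (a := ((0, 0) : ℝ × ℝ)) (b := (1, 1))) ?_)
      ((meshTri_subset_unitSquare n k).trans fun x hx =>
        ⟨⟨hx.1.1.le, hx.2.1.le⟩, ⟨hx.1.2.le, hx.2.2.le⟩⟩)
    apply Continuous.continuousOn
    unfold triMap quadX quadY
    fun_prop
  · rw [setIntegral_congr_fun hm hpt, integral_const_mul]
    have := setIntegral_refTriangle_comp (triScale n k.2.2) (triShift k.2.2 k.1)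
      (triShift k.2.2 k.2.1) (fun p => quadX q p * quadX l p + quadY q p * quadY l p)
    refine (congrArg _ this).trans ?_
    -- The square of the scale from the two derivatives cancels the Jacobian, so the mesh size
    -- disappears.
    rw [mul_inv_cancel_left₀ (pow_ne_zero 2 hc), refEnergy]

theorem stiffnessP2_eq_sum_refEnergy {n : ℕ} (hn : 0 < n)
    {q : TriIndex n → P2Index n → Fin 6 → ℝ}
    (hq : ∀ k i, ∀ x ∈ meshTri n k, p2Basis n i x = quad (q k i) (triMap n k x))
    (i j : P2Index n) :
    stiffnessP2 (fun _ => 1) n i j = ∑ k, refEnergy (q k j) (q k i) := by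
  rw [stiffnessP2, Matrix.of_apply]
  simp only [one_mul]
  rw [setIntegral_congr_set (unitSquare_ae_eq_iUnion_meshTri n hn),
    integral_iUnion_fintype (fun k => (isOpen_meshTri n k).measurableSet)
      (pairwise_disjoint_meshTri n) fun k => (dirichlet_meshTri (hq k j) (hq k i)).1]
  exact Finset.sum_congr rfl fun k _ => (dirichlet_meshTri (hq k j) (hq k i)).2

theorem stiffnessP2_symm (a : ℝ × ℝ → ℝ) (n : ℕ) (i j : P2Index n) :
    stiffnessP2 a n i j = stiffnessP2 a n j i := by
  simp only [stiffnessP2, Matrix.of_apply]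
  congr 1
  funext x
  ring

/-! ### Node weights and the spectral bound for the stiffness matrix -/

/-- Summation with the weights `1, 2, 1` over the cells of a one-dimensional grid. -/
theorem sum_cell_weights (n : ℕ) (hn : 0 < n) (g : ℕ → ℝ) (h0 : g 0 = 0) (hn0 : g (2 * n) = 0) :
    ∑ a : Fin n, (g (2 * a) + 2 * g (2 * a + 1) + g (2 * a + 2)) =
      2 * ∑ P : Fin (2 * n - 1), g (P + 1) := by
  -- Interior even points belong to two cells and receive `1 + 1`, odd points receive `2`, and the
  -- two end points only `1`; hence the corrections `- g 0 + g (2 * m)`.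
  have h1 : ∀ m : ℕ, ∑ a ∈ Finset.range m, (g (2 * a) + 2 * g (2 * a + 1) + g (2 * a + 2)) =
      2 * ∑ P ∈ Finset.range (2 * m), g P - g 0 + g (2 * m) := by
    intro m
    induction m with
    | zero => simp
    | succ m ih =>
      rw [Finset.sum_range_succ, ih, Nat.mul_succ, Finset.sum_range_succ, Finset.sum_range_succ]
      ring
  rw [Fin.sum_univ_eq_sum_range (fun a => g (2 * a) + 2 * g (2 * a + 1) + g (2 * a + 2)),
    Fin.sum_univ_eq_sum_range (fun P => g (P + 1)), h1, h0, hn0]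
  obtain ⟨m, hm⟩ : ∃ m, 2 * n = m + 1 := ⟨2 * n - 1, by omega⟩
  rw [hm, Finset.sum_range_succ', h0]
  simp

/-- The bounds of `refEnergy_self_le` at the triangles of a cell, added over all cells. -/
theorem sum_mesh_weights (n : ℕ) (hn : 0 < n) (W : ℕ → ℕ → ℝ)
    (hW : ∀ P Q, P ≤ 2 * n → Q ≤ 2 * n → (P = 0 ∨ P = 2 * n ∨ Q = 0 ∨ Q = 2 * n) → W P Q = 0) :
    ∑ a : Fin n, ∑ b : Fin n, (8 / 3 * (W (2 * a) (2 * b) + W (2 * a + 2) (2 * b + 2) +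
        W (2 * a + 2) (2 * b) + W (2 * a) (2 * b + 2)) +
      16 / 3 * (W (2 * a + 1) (2 * b) + W (2 * a) (2 * b + 1) + W (2 * a + 1) (2 * b + 2) +
        W (2 * a + 2) (2 * b + 1) + 2 * W (2 * a + 1) (2 * b + 1))) =
      32 / 3 * ∑ i : P2Index n, W (i.1 + 1) (i.2 + 1) := by
  have hrow : ∀ P, P ≤ 2 * n → 2 * ∑ Q : Fin (2 * n - 1), W P (Q + 1) =
      ∑ b : Fin n, (W P (2 * b) + 2 * W P (2 * b + 1) + W P (2 * b + 2)) := fun P hP =>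
    (sum_cell_weights n hn (W P) (hW P 0 hP (by omega) (by simp))
      (hW P (2 * n) hP le_rfl (by simp))).symm
  have hcol := sum_cell_weights n hn (fun P => ∑ Q : Fin (2 * n - 1), W P (Q + 1))
    (Finset.sum_eq_zero fun Q _ => hW _ _ (by omega) (by omega) (by simp))
    (Finset.sum_eq_zero fun Q _ => hW _ _ le_rfl (by omega) (by simp))
  rw [Fintype.sum_prod_type, show (32 : ℝ) / 3 = 16 / 3 * 2 by norm_num, mul_assoc, ← hcol,
    Finset.mul_sum]
  refine Finset.sum_congr rfl fun a _ => ?_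
  -- The weights in a cell are `8/3` times the tensor product of `(1, 2, 1)` with itself, so the
  -- one-dimensional sum is applied in each direction.
  rw [show ∀ x y z : ℝ, 16 / 3 * (x + 2 * y + z) = 8 / 3 * (2 * x + 2 * (2 * y) + 2 * z) from
    fun x y z => by ring, hrow _ (by omega),
    hrow _ (by omega), hrow _ (by omega), Finset.mul_sum, ← Finset.sum_add_distrib,
    ← Finset.sum_add_distrib, Finset.mul_sum]
  refine Finset.sum_congr rfl fun b _ => ?_
  ring

/-- The finite element function with nodal values `x`. -/
noncomputable def feFun (n : ℕ) (x : P2Index n → ℝ) (p : ℝ × ℝ) : ℝ := ∑ i, x i * p2Basis n i p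

/-- The values of a finite element function on the grid of step `1/(2n)`. -/
noncomputable def gridValue (n : ℕ) (x : P2Index n → ℝ) (P Q : ℕ) : ℝ :=
  feFun n x ((P : ℝ) / (2 * n), (Q : ℝ) / (2 * n))

theorem gridValue_node (n : ℕ) (x : P2Index n → ℝ) (i : P2Index n) :
    gridValue n x (i.1 + 1) (i.2 + 1) = x i := by
  have := fun j => p2Basis_node n j i
  simp only [p2Node] at this
  push_cast at this
  simp [gridValue, feFun, this]

theorem feFun_eq_zero_of_frontier (n : ℕ) (x : P2Index n → ℝ) {p : ℝ × ℝ}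
    (hp : p ∈ frontier unitSquare) : feFun n x p = 0 :=
  Finset.sum_eq_zero fun i _ => by rw [(p2Basis_mem n i).2.2 p hp, mul_zero]

theorem mem_frontier_unitSquare {s t : ℝ} (hs : s ∈ Set.Icc (0 : ℝ) 1) (ht : t ∈ Set.Icc (0 : ℝ) 1)
    (h : s = 0 ∨ s = 1 ∨ t = 0 ∨ t = 1) : (s, t) ∈ frontier unitSquare := by
  rw [unitSquare, frontier_prod_eq, frontier_Ioo one_pos, closure_Ioo zero_ne_one]
  rcases h with h | h | h | h
  · exact Or.inr ⟨Or.inl h, ht⟩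
  · exact Or.inr ⟨Or.inr h, ht⟩
  · exact Or.inl ⟨hs, Or.inl h⟩
  · exact Or.inl ⟨hs, Or.inr h⟩

/-- The homogeneous Dirichlet condition: boundary points enter the cell sums with value zero, as
`sum_mesh_weights` requires. -/
theorem gridValue_boundary {n : ℕ} (hn : 0 < n) (x : P2Index n → ℝ) {P Q : ℕ} (hP : P ≤ 2 * n)
    (hQ : Q ≤ 2 * n) (h : P = 0 ∨ P = 2 * n ∨ Q = 0 ∨ Q = 2 * n) : gridValue n x P Q = 0 := by
  have hn' : (0 : ℝ) < 2 * n := by positivity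
  have aux : ∀ R : ℕ, R ≤ 2 * n → (R : ℝ) / (2 * n) ∈ Set.Icc (0 : ℝ) 1 := by
    intro R hR
    have : (R : ℝ) ≤ 2 * n := by exact_mod_cast hR
    exact ⟨by positivity, (div_le_one hn').2 this⟩
  refine feFun_eq_zero_of_frontier n x (mem_frontier_unitSquare (aux P hP) (aux Q hQ) ?_)
  rcases h with rfl | rfl | rfl | rfl
  · left; simp
  · right; left; push_cast; exact div_self hn'.ne'
  · right; right; left; simp
  · right; right; right; push_cast; exact div_self hn'.ne'

/-- Identifies the nodal values on the reference triangle with values on the global grid, so that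
the bounds of adjacent triangles refer to the same numbers. -/
theorem quad_sum_eq_gridValue {n : ℕ} {k : TriIndex n} {q : P2Index n → Fin 6 → ℝ}
    (hq : ∀ i, ∀ x, 0 ≤ (triMap n k x).1 → 0 ≤ (triMap n k x).2 →
      (triMap n k x).1 + (triMap n k x).2 ≤ 1 → p2Basis n i x = quad (q i) (triMap n k x))
    (x : P2Index n → ℝ) {P Q : ℕ} {s t : ℝ} (hs : 0 ≤ s) (ht : 0 ≤ t) (hst : s + t ≤ 1)
    (h : triMap n k ((P : ℝ) / (2 * n), (Q : ℝ) / (2 * n)) = (s, t)) :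
    quad (∑ i, x i • q i) (s, t) = gridValue n x P Q := by
  rw [quad_sum, gridValue, feFun]
  refine Finset.sum_congr rfl fun i _ => ?_
  rw [hq i _ (by rw [h]; exact hs) (by rw [h]; exact ht) (by rw [h]; exact hst), h]

/-- The eigenvalues of the stiffness matrix lie in `[0, 32/3]`. -/
theorem spectrum_stiffnessP2_subset (n : ℕ) (hn : 0 < n) :
    spectrum ℂ ((stiffnessP2 (fun _ => 1) n).map (fun t : ℝ => (t : ℂ))) ⊆
      ((↑) : ℝ → ℂ) '' Set.Icc 0 (32 / 3) := by
  have hn' : (n : ℝ) ≠ 0 := by positivity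
  choose q hq using fun k => fun i => p2Basis_eq_quad n k i
  have hq' : ∀ k i, ∀ x ∈ meshTri n k, p2Basis n i x = quad (q k i) (triMap n k x) :=
    fun k i x hx => hq k i x hx.1.le hx.2.1.le hx.2.2.le
  refine spectrum_map_ofReal_subset_Icc _ (stiffnessP2_symm _ n) _ fun x => ?_
  have hform : ∑ i, ∑ j, x i * stiffnessP2 (fun _ => 1) n i j * x j =
      ∑ k, refEnergy (∑ i, x i • q k i) (∑ i, x i • q k i) := by
    simp only [refEnergy_sum, stiffnessP2_eq_sum_refEnergy hn hq', Finset.mul_sum, Finset.sum_mul]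
    rw [Finset.sum_comm]
    conv_lhs =>
      enter [2, j]
      rw [Finset.sum_comm]
    rw [Finset.sum_comm]
    exact Finset.sum_congr rfl fun k _ => Finset.sum_comm
  rw [hform]
  refine ⟨Finset.sum_nonneg fun k _ => refEnergy_self_nonneg _, ?_⟩
  have hsum := sum_mesh_weights n hn (fun P Q => gridValue n x P Q ^ 2) fun P Q hP hQ h => by
    rw [gridValue_boundary hn x hP hQ h, zero_pow two_ne_zero]
  simp only [gridValue_node] at hsum
  rw [← hsum, Fintype.sum_prod_type]
  refine Finset.sum_le_sum fun a _ => ?_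
  rw [Fintype.sum_prod_type]
  refine Finset.sum_le_sum fun b _ => ?_
  rw [Fintype.sum_bool]
  have hlow : ∀ {P Q : ℕ} {s t : ℝ}, 0 ≤ s → 0 ≤ t → s + t ≤ 1 → (P : ℝ) = 2 * (a : ℕ) + 2 * s →
      (Q : ℝ) = 2 * (b : ℕ) + 2 * t →
      quad (∑ i, x i • q (a, b, false) i) (s, t) = gridValue n x P Q := by
    intro P Q s t hs ht hst hP hQ
    refine quad_sum_eq_gridValue (hq _) x hs ht hst ?_
    simp only [triMap, triScale, triShift, cond_false, hP, hQ]
    refine Prod.ext ?_ ?_ <;> field_simp <;> ring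
  -- The upper triangle is reflected: its right angle, the reference origin, is at `(2a + 2, 2b +
  -- 2)` on the doubled grid.
  have hupp : ∀ {P Q : ℕ} {s t : ℝ}, 0 ≤ s → 0 ≤ t → s + t ≤ 1 →
      (P : ℝ) = 2 * (a : ℕ) + 2 - 2 * s → (Q : ℝ) = 2 * (b : ℕ) + 2 - 2 * t →
      quad (∑ i, x i • q (a, b, true) i) (s, t) = gridValue n x P Q := by
    intro P Q s t hs ht hst hP hQ
    refine quad_sum_eq_gridValue (hq _) x hs ht hst ?_
    simp only [triMap, triScale, triShift, cond_true, hP, hQ]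
    refine Prod.ext ?_ ?_ <;> field_simp <;> ring
  have elow := refEnergy_self_le (∑ i, x i • q (a, b, false) i)
  have eupp := refEnergy_self_le (∑ i, x i • q (a, b, true) i)
  rw [hlow (P := 2 * a) (Q := 2 * b), hlow (P := 2 * a + 2) (Q := 2 * b),
    hlow (P := 2 * a) (Q := 2 * b + 2), hlow (P := 2 * a + 1) (Q := 2 * b),
    hlow (P := 2 * a) (Q := 2 * b + 1), hlow (P := 2 * a + 1) (Q := 2 * b + 1)] at elow
  rw [hupp (P := 2 * a + 2) (Q := 2 * b + 2), hupp (P := 2 * a) (Q := 2 * b + 2),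
    hupp (P := 2 * a + 2) (Q := 2 * b), hupp (P := 2 * a + 1) (Q := 2 * b + 2),
    hupp (P := 2 * a + 2) (Q := 2 * b + 1), hupp (P := 2 * a + 1) (Q := 2 * b + 1)] at eupp
  -- The two ends of the diagonal receive `4/3` from each triangle, so all four corners weigh `8/3`;
  -- the midpoint of the diagonal is counted twice.
  · linarith
  all_goals push_cast; linarith

/-! ### The theorem -/

theorem corollary3p3p1 :
    (IsWeaklyClusteredAt (fun n : ℕ => blockToeplitz n n symbolP2)
        (eigenvalueRange symbolP2 torusSquare) ∧
      IsWeaklyClusteredAt (fun n : ℕ => (stiffnessP2 (fun _ => 1) n).map (fun t : ℝ => (t : ℂ)))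
        (eigenvalueRange symbolP2 torusSquare)) ∧
    ∀ n : ℕ, 1 ≤ n →
      spectrum ℂ (blockToeplitz n n symbolP2) ⊆
          convexHull ℝ (eigenvalueRange symbolP2 torusSquare) ∧
        spectrum ℂ ((stiffnessP2 (fun _ => 1) n).map (fun t : ℝ => (t : ℂ))) ⊆
          convexHull ℝ (eigenvalueRange symbolP2 torusSquare) := by
  have hT : ∀ n, spectrum ℂ (blockToeplitz n n symbolP2) ⊆
      eigenvalueRange symbolP2 torusSquare := fun n => by
    rw [eigenvalueRange_symbolP2]
    exact spectrum_blockToeplitz_subset n n symbolP2 symbolP2_continuous _ symbolP2_quadForm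
  have hA : ∀ n, 1 ≤ n → spectrum ℂ ((stiffnessP2 (fun _ => 1) n).map (fun t : ℝ => (t : ℂ))) ⊆
      eigenvalueRange symbolP2 torusSquare := fun n hn => by
    rw [eigenvalueRange_symbolP2]
    exact spectrum_stiffnessP2_subset n hn
  have hne : (eigenvalueRange symbolP2 torusSquare).Nonempty := by
    rw [eigenvalueRange_symbolP2]
    exact ⟨_, Set.mem_image_of_mem _ (Set.left_mem_Icc.2 (by norm_num))⟩
  have hcl : IsClosed (eigenvalueRange symbolP2 torusSquare) := by
    rw [eigenvalueRange_symbolP2]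
    exact (isCompact_Icc.image Complex.continuous_ofReal).isClosed
  exact ⟨⟨isWeaklyClusteredAt_of_spectrum_subset _ hne hcl (Eventually.of_forall hT),
      isWeaklyClusteredAt_of_spectrum_subset _ hne hcl
        -- Clustering is asymptotic, so `n = 0`, where there is no mesh, may be discarded.
        (eventually_atTop.2 ⟨1, fun n hn => hA n hn⟩)⟩,
    fun n hn => ⟨(hT n).trans (subset_convexHull ℝ _), (hA n hn).trans (subset_convexHull ℝ _)⟩⟩
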